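/- **Setting.** Let $b:\mathbb R\to\mathbb R$, $c\ge 0$ measurable, $\phi^*>0$ be such that for every $\theta\in\mathbb R$ the function $y\mapsto \exp\{(y\theta-b(\theta))/\phi^*\}c(y)$ is a probability density with respect to a fixed measure on $\mathbb R$. For each sample size $n$ let $p=p_n\ge 2$, with $\log p=O(n^\eta)$ for some $\eta\in(0,1)$, let $X\in\mathbb R^{n\times p}$ be a fixed design matrix with rows $x_i'$ and columns $X_j$, let $\beta^*\in\mathbb R^p$, and let $y_1,\dots,y_n$ be independent, $y_i$ having the above density with $\theta=x_i'\beta^*$. Let $\mathcal M\subseteq\{1,\dots,p\}$, $m=|\mathcal M|$, $\mathcal S=\{j\notin\mathcal M:\beta^*_j\ne0\}$, $s=|\mathcal S|$, let $C\in\mathbb R^{r\times m}$ have full row rank, $t\in\mathbb R^r$, $h_n=C\beta^*_{\mathcal M}-t$, and $\lambda=\lambda_n>0$. All of $p,X,\beta^*,\mathcal M,C,r,t,\lambda$ may vary with $n$; let $a,a_1>0$ be constants (those of the folded-concave penalty). Put $$\ell_n(\beta)=-\frac1n\sum_{i=1}^n\{y_ix_i'\beta-b(x_i'\beta)\},\qquad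 \Sigma(v)=\operatorname{diag}\{b''(v_1),\dots,b''(v_n)\}.$$ The reduced oracle estimator $\hat\beta_0$ minimizes $\ell_n(\beta)$ subject to $\beta_{(\mathcal M\cup\mathcal S)^c}=0$ and $C\beta_{\mathcal M}=t$; the full oracle estimator $\hat\beta_a$ minimizes $\ell_n(\beta)$ subject to $\beta_{(\mathcal M\cup\mathcal S)^c}=0$. Let $$\mathcal N_0=\Big\{\beta:\ \|\beta_{\mathcal M\cup\mathcal S}-\beta^*_{\mathcal M\cup\mathcal S}\|_2\le\sqrt{(s+m)\log n/n},\ \beta_{(\mathcal M\cup\mathcal S)^c}=0\Big\}.$$ **Assumptions.** As $n\to\infty$: - (A1) $\hat\beta_0$ exists, $C\hat\beta_{0,\mathcal M}=t$, and for some $\nu\in\mathbb R^r$ one has $\nabla_{\mathcal M}\ell_n(\hat\beta_0)=C'\nu$ and $\nabla_{\mathcal S}\ell_n(\hat\beta_0)=0$; it suffices that this holds with probability tending to $1$. - (A2) $\hat\beta_a$ exists and $\nabla_{\mathcal M\cup\mathcal S}\ell_n(\hat\beta_a)=0$; again with probability tending to $1$ suffices. - (A3) $\min_{j\in\mathcal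 S}|\beta^*_j|>(a+1)\lambda$ for all large $n$. - (A4) $h_n\to0$, $\lambda_{\max}\{(CC')^{-1}\}=O(1)$ and $\|h_n\|_2=O(\sqrt{\min\{s+m-r,\,r\}/n})$. - (A5) $\max\{\sqrt{s+m},\sqrt{\log p}\}/\sqrt n=o(\lambda)$. - (A6) For some $\kappa>0$ and all large $n$, $\inf_{\beta\in\mathcal N_0}\lambda_{\min}\{X_{\mathcal M\cup\mathcal S}'\Sigma(X\beta)X_{\mathcal M\cup\mathcal S}\}\ge \kappa n$; moreover $\sup_{\beta\in\mathcal N_0}\max_{1\le j\le p}\lambda_{\max}\{X_{\mathcal M\cup\mathcal S}'\operatorname{diag}(|X_{ij}|\,|b'''(x_i'\beta)|)_{i\le n}X_{\mathcal M\cup\mathcal S}\}=O(n)$, $\lambda_{\max}\{X_{\mathcal M\cup\mathcal S}'\Sigma(X\beta^*)X_{\mathcal M\cup\mathcal S}\}=O(n)$, and $\|X_{(\mathcal M\cup\mathcal S)^c}'\Sigma(X\beta^*)X_{\mathcal M\cup\mathcal S}\|_\infty=O(n)$ (maximal absolute row sum). - (A7) There are constants $B_1,B_2$ with $\max_j\|X_j\|_2^2\le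 B_1n$ and $\max_j\|X_j\|_\infty\le B_2\sqrt{n/\log p}$ for all $n$. - (A8) There are constants $K,v_0>0$ such that for all $n$, with $e_i=|y_i-b'(x_i'\beta^*)|$, $\max_{1\le i\le n}\mathbb E\big[\exp(e_i/K)-1-e_i/K\big]K^2\le v_0/2$. **Theorem.** If (A1)–(A8) hold and $s+m=o(n^{1/2})$, then, as $n\to\infty$, for both $\hat\beta=\hat\beta_0$ and $\hat\beta=\hat\beta_a$, $$\Pr\Big(\max_{j\notin\mathcal M\cup\mathcal S}|\nabla_j\ell_n(\hat\beta)|\ge a_1\lambda\Big)\to0\qquad\text{and}\qquad \Pr\Big(\min_{j\in\mathcal S}|\hat\beta_j|\le a\lambda\Big)\to0 ,$$ where events over an empty index set are empty. -/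

import Mathlib

open MeasureTheory ProbabilityTheory Filter Topology Asymptotics Matrix

noncomputable section

namespace PartialGLM

/-! ### The exponential family -/

/-- The canonical density `exp ((y θ - b θ) / φ) c(y)` with natural parameter `θ`. -/
def glmDensity (b c : ℝ → ℝ) (φ θ y : ℝ) : ℝ :=
  Real.exp ((y * θ - b θ) / φ) * c y

/-- `glmDensity b c φ θ` is, for every real natural parameter `θ`, a probability density with
respect to the dominating measure `ν` (Lebesgue measure, counting measure, ...); `φ > 0` is the
dispersion. -/
structure IsExponentialFamily (ν : Measure ℝ) (b c : ℝ → ℝ) (φ : ℝ) : Prop where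
  dispersion_pos : 0 < φ
  measurable_c : Measurable c
  c_nonneg : ∀ y, 0 ≤ c y
  lintegral_eq_one : ∀ θ : ℝ, ∫⁻ y, ENNReal.ofReal (glmDensity b c φ θ y) ∂ν = 1

/-! ### The deterministic data at sample size `n` -/

/-- The non-random ingredients of the testing problem with `n` observations. -/
structure Design (n : ℕ) where
  /-- number of predictors -/
  p : ℕ
  /-- the (fixed) design matrix -/
  X : Matrix (Fin n) (Fin p) ℝ
  /-- the true coefficient vector -/
  βs : Fin p → ℝ
  /-- the set of coefficients that are tested, and left unpenalized -/
  M : Finset (Fin p)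
  /-- number of linear constraints -/
  r : ℕ
  /-- the constraint matrix -/
  C : Matrix (Fin r) M ℝ
  /-- the right-hand side of the constraints -/
  t : Fin r → ℝ
  /-- the penalty parameter `λ` -/
  lam : ℝ

namespace Design

variable {n : ℕ} (D : Design n)

/-- `S`: the indices outside `M` at which the true coefficient vector does not vanish. -/
def S : Finset (Fin D.p) := Finset.univ.filter fun j => j ∉ D.M ∧ D.βs j ≠ 0

/-- `M ∪ S`. -/
def MS : Finset (Fin D.p) := D.M ∪ D.S

/-- `m = |M|`. -/
def m : ℕ := D.M.card

/-- `s = |S|`. -/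
def s : ℕ := D.S.card

/-- The vector `C β_M`. -/
def constr (β : Fin D.p → ℝ) : Fin D.r → ℝ := D.C *ᵥ fun j : D.M => β j

/-- The local deviation `h_n = C β*_M - t`. -/
def h : Fin D.r → ℝ := D.constr D.βs - D.t

/-- The Euclidean norm of `h_n`. -/
def hNorm : ℝ := Real.sqrt (∑ k, D.h k ^ 2)

/-- The submatrix `X_{M ∪ S}`. -/
def XMS : Matrix (Fin n) D.MS ℝ := D.X.submatrix id fun j : D.MS => (j : Fin D.p)

/-- The submatrix of the columns of `X` with index outside `M ∪ S`. -/
def XMSc : Matrix (Fin n) {j : Fin D.p // j ∉ D.MS} ℝ :=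
  D.X.submatrix id fun j : {j : Fin D.p // j ∉ D.MS} => (j : Fin D.p)

/-- The diagonal matrix `Σ(X β)`, with entries `b''(x_i' β)`. -/
def Sig (b : ℝ → ℝ) (β : Fin D.p → ℝ) : Matrix (Fin n) (Fin n) ℝ :=
  Matrix.diagonal fun i => iteratedDeriv 2 b ((D.X *ᵥ β) i)

/-- The diagonal matrix `diag { |X_j| ∘ |b'''(X β)| }`. -/
def thirdDiag (b : ℝ → ℝ) (β : Fin D.p → ℝ) (j : Fin D.p) : Matrix (Fin n) (Fin n) ℝ :=
  Matrix.diagonal fun i => |D.X i j| * |iteratedDeriv 3 b ((D.X *ᵥ β) i)|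

/-- The neighbourhood `N_0` of the true coefficient vector. -/
def N0 : Set (Fin D.p → ℝ) :=
  {β | Real.sqrt (∑ j ∈ D.MS, (β j - D.βs j) ^ 2)
        ≤ Real.sqrt (((D.s : ℝ) + D.m) * Real.log n / n) ∧ ∀ j ∉ D.MS, β j = 0}

/-- The GLM loss `ℓ_n(β) = - (1/n) ∑ᵢ { yᵢ xᵢ'β - b(xᵢ'β) }`. -/
def loss (b : ℝ → ℝ) (y : Fin n → ℝ) (β : Fin D.p → ℝ) : ℝ :=
  -(1 / (n : ℝ)) * ∑ i, (y i * (D.X *ᵥ β) i - b ((D.X *ᵥ β) i))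

/-- The `j`-th entry of the gradient of the GLM loss at `β`. -/
def grad (b : ℝ → ℝ) (y : Fin n → ℝ) (β : Fin D.p → ℝ) (j : Fin D.p) : ℝ :=
  fderiv ℝ (D.loss b y) β (Pi.single j 1)

/-- The vectors supported in `M ∪ S` (equivalently, in the union of `M` and the true support). -/
def fullFeasible : Set (Fin D.p → ℝ) := {β | ∀ j ∉ D.MS, β j = 0}

/-- The vectors supported in `M ∪ S` that satisfy the constraints of the null hypothesis. -/
def reducedFeasible : Set (Fin D.p → ℝ) := {β | (∀ j ∉ D.MS, β j = 0) ∧ D.constr β = D.t}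

/-- `β` is a reduced oracle estimate for the responses `y`: a minimizer of the loss over the
vectors supported in `M ∪ S` with `C β_M = t`. -/
def IsReducedOracle (b : ℝ → ℝ) (y : Fin n → ℝ) (β : Fin D.p → ℝ) : Prop :=
  β ∈ D.reducedFeasible ∧ IsMinOn (D.loss b y) D.reducedFeasible β

/-- `β` is a full oracle estimate for the responses `y`: a minimizer of the loss over the
vectors supported in `M ∪ S`. -/
def IsFullOracle (b : ℝ → ℝ) (y : Fin n → ℝ) (β : Fin D.p → ℝ) : Prop :=
  β ∈ D.fullFeasible ∧ IsMinOn (D.loss b y) D.fullFeasible β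

/-- For some `η`, the gradient in the coordinates `M ∪ S` is `(C' η, 0)`; and `C β_M = t`. -/
def ReducedStationary (b : ℝ → ℝ) (y : Fin n → ℝ) (β : Fin D.p → ℝ) : Prop :=
  (∃ η : Fin D.r → ℝ,
    (∀ j : D.M, D.grad b y β j = (D.Cᵀ *ᵥ η) j) ∧ ∀ j ∈ D.S, D.grad b y β j = 0) ∧
  D.constr β = D.t

/-- The gradient vanishes in the coordinates `M ∪ S`. -/
def FullStationary (b : ℝ → ℝ) (y : Fin n → ℝ) (β : Fin D.p → ℝ) : Prop :=
  ∀ j ∈ D.MS, D.grad b y β j = 0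

/-- The responses are independent and `y_i` has density `glmDensity` with natural parameter
`x_i' β*` with respect to `ν`. -/
structure IsSample {Ω : Type*} [MeasurableSpace Ω] (ν : Measure ℝ) (b c : ℝ → ℝ) (φ : ℝ)
    (P : Measure Ω) (y : Ω → Fin n → ℝ) : Prop where
  measurable : ∀ i, Measurable fun ω => y ω i
  indep : iIndepFun (fun i ω => y ω i) P
  law : ∀ i, P.map (fun ω => y ω i) =
    ν.withDensity fun v => ENNReal.ofReal (glmDensity b c φ ((D.X *ᵥ D.βs) i) v)

end Design

/-! ### Eigenvalue bounds -/

/-- Every eigenvalue of `A` is at most `K`, that is `λ_max(A) ≤ K` (used for symmetric `A`). -/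
def LamMaxLE {ι : Type*} [Fintype ι] [DecidableEq ι] (A : Matrix ι ι ℝ) (K : ℝ) : Prop :=
  ∀ μ ∈ spectrum ℝ A, μ ≤ K

/-- Every eigenvalue of `A` is at least `K`, that is `K ≤ λ_min(A)` (used for symmetric `A`). -/
def LamMinGE {ι : Type*} [Fintype ι] [DecidableEq ι] (A : Matrix ι ι ℝ) (K : ℝ) : Prop :=
  ∀ μ ∈ spectrum ℝ A, K ≤ μ

/-! ### The assumptions on a sequence of problems -/

/-- Minimal signal strength: `‖β*_S‖_min > (a + 1) λ`. -/
def MinSignal (D : (n : ℕ) → Design n) (a : ℝ) : Prop :=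
  ∀ᶠ n in atTop, ∀ j ∈ (D n).S, (a + 1) * (D n).lam < |(D n).βs j|

/-- The null hypothesis or a sequence of local alternatives holds. -/
structure LocalAlternatives (D : (n : ℕ) → Design n) : Prop where
  tendsto_h : Tendsto (fun n => (D n).hNorm) atTop (𝓝 0)
  eig_C : ∃ K : ℝ, ∀ᶠ n in atTop, LamMaxLE ((D n).C * (D n).Cᵀ)⁻¹ K
  rate_h : (fun n => (D n).hNorm) =O[atTop] fun n =>
    Real.sqrt (min (((D n).s : ℝ) + (D n).m - (D n).r) ((D n).r : ℝ) / n)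

/-- `max { √(s+m), √(log p) } / √n = o(λ)`. -/
def LambdaRate (D : (n : ℕ) → Design n) : Prop :=
  (fun n => max (Real.sqrt (((D n).s : ℝ) + (D n).m)) (Real.sqrt (Real.log (D n).p))
      / Real.sqrt n) =o[atTop] fun n => (D n).lam

/-- The conditions on `X' Σ X` and on its third-derivative analogue near `β*`. -/
structure HessianConditions (D : (n : ℕ) → Design n) (b : ℝ → ℝ) : Prop where
  min_hessian : ∃ κ : ℝ, 0 < κ ∧ ∀ᶠ n in atTop, ∀ β ∈ (D n).N0,
    LamMinGE ((D n).XMSᵀ * (D n).Sig b β * (D n).XMS) (κ * n)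
  third_derivative : ∃ K : ℝ, ∀ᶠ n in atTop, ∀ β ∈ (D n).N0, ∀ j,
    LamMaxLE ((D n).XMSᵀ * (D n).thirdDiag b β j * (D n).XMS) (K * n)
  max_hessian : ∃ K : ℝ, ∀ᶠ n in atTop,
    LamMaxLE ((D n).XMSᵀ * (D n).Sig b (D n).βs * (D n).XMS) (K * n)
  /-- The norm `‖·‖_∞` is the maximal absolute row sum. -/
  cross_hessian : ∃ K : ℝ, ∀ᶠ n in atTop, ∀ j,
    ∑ k, |((D n).XMScᵀ * (D n).Sig b (D n).βs * (D n).XMS) j k| ≤ K * n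

/-- The bounds on the columns of the design matrix. -/
def ColumnBounds (D : (n : ℕ) → Design n) : Prop :=
  ∃ B₁ B₂ : ℝ, ∀ n, ∀ j,
    ∑ i, (D n).X i j ^ 2 ≤ B₁ * n ∧
    ∀ i, |(D n).X i j| ≤ B₂ * Real.sqrt (n / Real.log (D n).p)

/-- The uniform exponential moment bound on the centred responses. -/
def MomentBound {Ω : ℕ → Type*} [∀ n, MeasurableSpace (Ω n)] (P : ∀ n, Measure (Ω n))
    (D : (n : ℕ) → Design n) (b : ℝ → ℝ) (y : ∀ n, Ω n → Fin n → ℝ) : Prop :=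
  ∃ K v₀ : ℝ, 0 < K ∧ 0 < v₀ ∧ ∀ n, ∀ i,
    Integrable (fun ω => Real.exp (|y n ω i - deriv b (((D n).X *ᵥ (D n).βs) i)| / K) - 1
      - |y n ω i - deriv b (((D n).X *ᵥ (D n).βs) i)| / K) (P n) ∧
    (∫ ω, (Real.exp (|y n ω i - deriv b (((D n).X *ᵥ (D n).βs) i)| / K) - 1
      - |y n ω i - deriv b (((D n).X *ᵥ (D n).βs) i)| / K) ∂(P n)) * K ^ 2 ≤ v₀ / 2

/-- The event `‖∇_{(M ∪ S)ᶜ} ℓ_n(β̂)‖_max ≥ a₁ λ`. -/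
def gradEvent {n : ℕ} {Ω : Type*} (D : Design n) (b : ℝ → ℝ) (a₁ : ℝ) (y : Ω → Fin n → ℝ)
    (βhat : Ω → Fin D.p → ℝ) : Set Ω :=
  {ω | ∃ j, j ∉ D.MS ∧ a₁ * D.lam ≤ |D.grad b (y ω) (βhat ω) j|}

/-- The event `‖β̂_S‖_min ≤ a λ`. -/
def smallEvent {n : ℕ} {Ω : Type*} (D : Design n) (a : ℝ) (βhat : Ω → Fin D.p → ℝ) : Set Ω :=
  {ω | ∃ j ∈ D.S, |βhat ω j| ≤ a * D.lam}

end PartialGLM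

end

/-! Both estimators minimize the convex loss over a feasible set, inside the vectors supported in `M
∪ S`, that contains a point within `O(q)` of the truth, where `q = √((s+m)/n)`. For the full problem
this point is `β*` itself; for the reduced one it is `β*` minus the least-norm correction
`C'(CC')⁻¹h`, whose length is controlled by `‖h‖`.

Localization: on the sphere of radius `A q` about `β*`, which lies in `N0` once `log n ≥ A²`, the
Hessian bound makes the loss grow by at least `κA²q²/2 - ‖score‖ A q`. At the nearby feasible point
a third-order expansion bounds the loss from above by `loss(β*) + O(q²)` plus a score term; the
cubic remainder is harmless because `s + m = o(√n)`. If `‖score‖ ≤ κAq/8`, convexity along the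
segment from `β*` to the minimizer prevents the minimizer from leaving the ball
(`nrm_sub_le_of_score_le`).

Consequences: since `q = o(λ)`, coefficients in `S` move by less than `λ` and stay above `aλ`. A
gradient coordinate outside `M ∪ S` is minus the score coordinate, plus a cross-Hessian term and a
quadratic remainder, both `O(q)` (`abs_grad_le`).

Probability: Markov's inequality bounds the Euclidean norm of the score on `M ∪ S`
(`measure_nrm_score_le`); a Chernoff and union bound controls its maximum over all coordinates at
the scale `√(log p/n) = o(λ)` (`measure_score_ge_le`). For fixed `A` both failure probabilities are
bounded by quantities independent of `n` that vanish as `A → ∞`, so `n → ∞` is taken before `A → ∞`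
(`tendsto_measure_events`). -/

namespace PartialGLM

/-! ### Exponential families: smoothness and convexity of `b`, and the mean of the responses. -/

section ExponentialFamily

/-- The dominating measure weighted by the base density `c`. -/
noncomputable def baseMeasure (ν : Measure ℝ) (c : ℝ → ℝ) : Measure ℝ :=
  ν.withDensity fun y => ENNReal.ofReal (c y)

variable {ν : Measure ℝ} {b c : ℝ → ℝ} {φ : ℝ}

theorem withDensity_glmDensity (h : IsExponentialFamily ν b c φ) (θ : ℝ) :
    ν.withDensity (fun y => ENNReal.ofReal (glmDensity b c φ θ y)) =
      (baseMeasure ν c).withDensity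
        fun y => ENNReal.ofReal (Real.exp (θ * (y / φ) - b θ / φ)) := by
  rw [baseMeasure, ← withDensity_mul _ (h.measurable_c.ennreal_ofReal) (by fun_prop)]
  congr 1
  funext y
  rw [Pi.mul_apply, mul_comm, ← ENNReal.ofReal_mul (Real.exp_nonneg _), glmDensity]
  congr 3
  ring

theorem lintegral_base (h : IsExponentialFamily ν b c φ) (θ : ℝ) :
    ∫⁻ y, ENNReal.ofReal (Real.exp (θ * (y / φ) - b θ / φ)) ∂(baseMeasure ν c) = 1 := by
  have h1 := congrArg (fun m : Measure ℝ => m Set.univ) (withDensity_glmDensity h θ)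
  simp only [withDensity_apply _ MeasurableSet.univ, Measure.restrict_univ] at h1
  rw [← h1, h.lintegral_eq_one]

theorem integrable_exp_base (h : IsExponentialFamily ν b c φ) (θ : ℝ) :
    Integrable (fun y => Real.exp (θ * (y / φ))) (baseMeasure ν c) := by
  have h1 : Integrable (fun y => Real.exp (θ * (y / φ) - b θ / φ)) (baseMeasure ν c) := by
    refine ⟨by fun_prop, ?_⟩
    rw [hasFiniteIntegral_iff_ofReal (ae_of_all _ fun _ => Real.exp_nonneg _),
      lintegral_base h]
    exact ENNReal.one_lt_top
  refine (h1.mul_const (Real.exp (b θ / φ))).congr (ae_of_all _ fun y => ?_)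
  simp only [← Real.exp_add, sub_add_cancel]

theorem mgf_base (h : IsExponentialFamily ν b c φ) (θ : ℝ) :
    mgf (fun y => y / φ) (baseMeasure ν c) θ = Real.exp (b θ / φ) := by
  have h1 : ∫ y, Real.exp (θ * (y / φ) - b θ / φ) ∂(baseMeasure ν c) = 1 := by
    rw [integral_eq_lintegral_of_nonneg_ae (ae_of_all _ fun _ => Real.exp_nonneg _)
      (by fun_prop), lintegral_base h, ENNReal.toReal_one]
  simp only [Real.exp_sub, integral_div] at h1
  rw [div_eq_one_iff_eq (Real.exp_ne_zero _)] at h1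
  exact h1

theorem interior_integrableExpSet_base (h : IsExponentialFamily ν b c φ) :
    interior (integrableExpSet (fun y => y / φ) (baseMeasure ν c)) = Set.univ := by
  have : integrableExpSet (fun y => y / φ) (baseMeasure ν c) = Set.univ :=
    Set.eq_univ_of_forall fun θ => integrable_exp_base h θ
  rw [this, interior_univ]

/-- The cumulant function is a rescaled cumulant generating function. -/
theorem cumulant_eq (h : IsExponentialFamily ν b c φ) :
    b = fun θ => φ * cgf (fun y => y / φ) (baseMeasure ν c) θ := by
  funext θ
  rw [cgf, mgf_base h, Real.log_exp, mul_div_cancel₀ _ h.dispersion_pos.ne']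

/-- The normalizing constant of the tilt is the moment generating function `exp (b θ / φ)`. This
gives access to the identities expressing mean and variance under a tilt as derivatives of the
cumulant generating function. -/
theorem withDensity_glmDensity_eq_tilted (h : IsExponentialFamily ν b c φ) (θ : ℝ) :
    ν.withDensity (fun y => ENNReal.ofReal (glmDensity b c φ θ y)) =
      (baseMeasure ν c).tilted fun y => θ * (y / φ) := by
  rw [withDensity_glmDensity h, Measure.tilted]
  congr 1
  funext y
  have := mgf_base h θ
  rw [mgf] at this
  rw [this, Real.exp_sub]

/-- The family is defined for every real parameter, so the exponential moments are finite on the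
whole line and the cumulant generating function is analytic everywhere. -/
theorem contDiff_cumulant (h : IsExponentialFamily ν b c φ) : ContDiff ℝ 3 b := by
  rw [cumulant_eq h]
  refine contDiff_const.mul (contDiff_iff_contDiffAt.2 fun θ => ?_)
  exact (analyticAt_cgf (by rw [interior_integrableExpSet_base h]; trivial)).contDiffAt

theorem deriv_cumulant (h : IsExponentialFamily ν b c φ) (θ : ℝ) :
    ∫ y, y ∂(ν.withDensity fun y => ENNReal.ofReal (glmDensity b c φ θ y)) = deriv b θ := by
  have hθ : θ ∈ interior (integrableExpSet (fun y => y / φ) (baseMeasure ν c)) := by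
    rw [interior_integrableExpSet_base h]; trivial
  have h1 := integral_tilted_mul_self hθ
  rw [integral_div, div_eq_iff h.dispersion_pos.ne'] at h1
  rw [withDensity_glmDensity_eq_tilted h, h1]
  conv_rhs => rw [cumulant_eq h]
  rw [deriv_const_mul _ (analyticAt_cgf hθ).differentiableAt, mul_comm]

/-- Up to the factor `φ`, the second derivative is a variance under the tilted law. This is the
source of the convexity of the loss. -/
theorem iteratedDeriv_two_cumulant_nonneg (h : IsExponentialFamily ν b c φ) (θ : ℝ) :
    0 ≤ iteratedDeriv 2 b θ := by
  have hθ : θ ∈ interior (integrableExpSet (fun y => y / φ) (baseMeasure ν c)) := by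
    rw [interior_integrableExpSet_base h]; trivial
  rw [cumulant_eq h, iteratedDeriv_const_mul _ (analyticAt_cgf hθ).contDiffAt,
    ← variance_tilted_mul hθ]
  exact mul_nonneg h.dispersion_pos.le (variance_nonneg _ _)

theorem integrable_id_glm (h : IsExponentialFamily ν b c φ) (θ : ℝ) :
    Integrable (fun y : ℝ => y)
      (ν.withDensity fun y => ENNReal.ofReal (glmDensity b c φ θ y)) := by
  have hθ : θ ∈ interior (integrableExpSet (fun y => y / φ) (baseMeasure ν c)) := by
    rw [interior_integrableExpSet_base h]; trivial
  rw [withDensity_glmDensity_eq_tilted h]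
  have h1 : Integrable (fun y => y / φ) ((baseMeasure ν c).tilted fun y => θ * (y / φ)) := by
    have := memLp_tilted_mul hθ 1
    exact memLp_one_iff_integrable.1 (by simpa using this)
  refine (h1.mul_const φ).congr (ae_of_all _ fun y => ?_)
  exact div_mul_cancel₀ _ h.dispersion_pos.ne'

variable {n : ℕ} {D : Design n} {Ω : Type*} [MeasurableSpace Ω] {P : Measure Ω}
  {y : Ω → Fin n → ℝ}

theorem Design.IsSample.integrable (hy : D.IsSample ν b c φ P y)
    (h : IsExponentialFamily ν b c φ) (i : Fin n) : Integrable (fun ω => y ω i) P := by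
  have := integrable_id_glm h ((D.X *ᵥ D.βs) i)
  rw [← hy.law i] at this
  exact this.comp_measurable (hy.measurable i)

theorem Design.IsSample.integral_eq (hy : D.IsSample ν b c φ P y)
    (h : IsExponentialFamily ν b c φ) (i : Fin n) :
    ∫ ω, y ω i ∂P = deriv b ((D.X *ᵥ D.βs) i) := by
  rw [← deriv_cumulant h, ← hy.law i, integral_map (hy.measurable i).aemeasurable (by fun_prop)]

end ExponentialFamily

/-! ### From spectral bounds to quadratic forms. -/

section QuadraticForms


/-- Subtracting `K` times the identity shifts the spectrum by `-K`, so the shifted Hermitian matrix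
is positive semidefinite. -/
theorem LamMinGE.quadForm_le {ι : Type*} [Fintype ι] [DecidableEq ι] {A : Matrix ι ι ℝ}
    (hA : A.IsHermitian) {K : ℝ} (h : LamMinGE A K) (v : ι → ℝ) : K * ∑ j, v j ^ 2 ≤ v ⬝ᵥ A *ᵥ v := by
  have hpsd : (A - algebraMap ℝ (Matrix ι ι ℝ) K).PosSemidef := by
    rw [Matrix.posSemidef_iff_isHermitian_and_spectrum_nonneg]
    refine ⟨hA.sub ?_, ?_⟩
    · rw [Matrix.algebraMap_eq_diagonal]
      exact Matrix.isHermitian_diagonal _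
    · intro x hx
      rw [← spectrum.sub_singleton_eq, Set.sub_singleton] at hx
      obtain ⟨μ, hμ, rfl⟩ := hx
      exact sub_nonneg.2 (h μ hμ)
  have h1 := hpsd.dotProduct_mulVec_nonneg v
  rw [Matrix.sub_mulVec, dotProduct_sub, Algebra.algebraMap_eq_smul_one, Matrix.smul_mulVec,
    Matrix.one_mulVec, dotProduct_smul] at h1
  simp only [star_trivial, smul_eq_mul, sub_nonneg] at h1
  refine le_trans (le_of_eq ?_) h1
  simp [dotProduct, sq]

theorem LamMaxLE.quadForm_le {ι : Type*} [Fintype ι] [DecidableEq ι] {A : Matrix ι ι ℝ}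
    (hA : A.IsHermitian) {K : ℝ} (h : LamMaxLE A K) (v : ι → ℝ) : v ⬝ᵥ A *ᵥ v ≤ K * ∑ j, v j ^ 2 := by
  have h1 : LamMinGE (-A) (-K) := by
    intro μ hμ
    rw [← spectrum.neg_eq, Set.mem_neg] at hμ
    linarith [h _ hμ]
  have h2 := h1.quadForm_le hA.neg v
  rw [Matrix.neg_mulVec, dotProduct_neg] at h2
  linarith

theorem isHermitian_gram_diagonal {ι κ : Type*} [Fintype κ] [DecidableEq κ]
    (A : Matrix κ ι ℝ) (w : κ → ℝ) :
    (Aᵀ * Matrix.diagonal w * A).IsHermitian := by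
  have := Matrix.isHermitian_conjTranspose_mul_mul (B := A) (A := Matrix.diagonal w)
    (hA := Matrix.isHermitian_diagonal _)
  simpa using this

theorem quadForm_gram_diagonal {ι κ : Type*} [Fintype ι] [Fintype κ] [DecidableEq κ]
    (A : Matrix κ ι ℝ) (w : κ → ℝ) (v : ι → ℝ) :
    v ⬝ᵥ (Aᵀ * Matrix.diagonal w * A) *ᵥ v = ∑ i, w i * (A *ᵥ v) i ^ 2 := by
  rw [← Matrix.mulVec_mulVec, ← Matrix.mulVec_mulVec, Matrix.dotProduct_mulVec,
    Matrix.vecMul_transpose]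
  simp only [dotProduct, Matrix.mulVec_diagonal]
  exact Finset.sum_congr rfl fun i _ => by ring

end QuadraticForms

/-! ### One-variable Taylor inequalities on the unit interval, by repeated comparison of
derivatives. -/

section Taylor

theorem le_of_hasDerivAt_le {f g f' g' : ℝ → ℝ} (hf : ∀ t, HasDerivAt f (f' t) t)
    (hg : ∀ t, HasDerivAt g (g' t) t) (h0 : f 0 ≤ g 0)
    (h : ∀ t ∈ Set.Icc (0 : ℝ) 1, f' t ≤ g' t) : ∀ t ∈ Set.Icc (0 : ℝ) 1, f t ≤ g t := by
  have hmono : MonotoneOn (fun t => g t - f t) (Set.Icc 0 1) := by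
    refine monotoneOn_of_hasDerivWithinAt_nonneg (f' := fun t => g' t - f' t) (convex_Icc 0 1)
      (fun t _ => ((hg t).sub (hf t)).continuousAt.continuousWithinAt)
      (fun t _ => ((hg t).sub (hf t)).hasDerivWithinAt) fun t ht => ?_
    exact sub_nonneg.2 (h t (interior_subset ht))
  intro t ht
  have := hmono (Set.left_mem_Icc.2 zero_le_one) ht ht.1
  simp only at this
  linarith

theorem taylor_two_lower {f f' f'' : ℝ → ℝ} {c : ℝ} (hf : ∀ t, HasDerivAt f (f' t) t)
    (hf' : ∀ t, HasDerivAt f' (f'' t) t) (h : ∀ t ∈ Set.Icc (0 : ℝ) 1, c ≤ f'' t) :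
    f 0 + f' 0 + c / 2 ≤ f 1 := by
  have h1 : ∀ t ∈ Set.Icc (0 : ℝ) 1, f' 0 + c * t ≤ f' t :=
    le_of_hasDerivAt_le (fun t => by simpa using ((hasDerivAt_id' t).const_mul c).const_add (f' 0))
      hf' (by simp) h
  have h2 : ∀ t ∈ Set.Icc (0 : ℝ) 1, f 0 + f' 0 * t + c / 2 * t ^ 2 ≤ f t := by
    refine le_of_hasDerivAt_le (f' := fun t => f' 0 + c * t) (fun t => ?_) hf (by simp) h1
    have := (((hasDerivAt_id' t).const_mul (f' 0)).const_add (f 0)).fun_add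
      (((hasDerivAt_id' t).fun_pow 2).const_mul (c / 2))
    exact this.congr_deriv (by simp; ring)
  simpa using h2 1 (by simp)

theorem abs_taylor_two_le {f f' f'' : ℝ → ℝ} {c : ℝ} (hf : ∀ t, HasDerivAt f (f' t) t)
    (hf' : ∀ t, HasDerivAt f' (f'' t) t) (h : ∀ t ∈ Set.Icc (0 : ℝ) 1, |f'' t| ≤ c) :
    |f 1 - f 0 - f' 0| ≤ c / 2 := by
  have h1 := taylor_two_lower hf hf' (c := -c) fun t ht => (abs_le.1 (h t ht)).1
  have h2 := taylor_two_lower (c := -c) (fun t => (hf t).neg) (fun t => (hf' t).neg) fun t ht =>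
    neg_le_neg (abs_le.1 (h t ht)).2
  simp only [Pi.neg_apply] at h2
  rw [abs_le]
  constructor <;> linarith

theorem taylor_three_upper {f f' f'' f''' : ℝ → ℝ} {c : ℝ} (hf : ∀ t, HasDerivAt f (f' t) t)
    (hf' : ∀ t, HasDerivAt f' (f'' t) t) (hf'' : ∀ t, HasDerivAt f'' (f''' t) t)
    (h : ∀ t ∈ Set.Icc (0 : ℝ) 1, f''' t ≤ c) :
    f 1 ≤ f 0 + f' 0 + f'' 0 / 2 + c / 6 := by
  have h1 : ∀ t ∈ Set.Icc (0 : ℝ) 1, f'' t ≤ f'' 0 + c * t :=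
    le_of_hasDerivAt_le hf''
      (fun t => by simpa using ((hasDerivAt_id' t).const_mul c).const_add (f'' 0)) (by simp) h
  have h2 : ∀ t ∈ Set.Icc (0 : ℝ) 1, f' t ≤ f' 0 + f'' 0 * t + c / 2 * t ^ 2 := by
    refine le_of_hasDerivAt_le (g' := fun t => f'' 0 + c * t) hf' (fun t => ?_) (by simp) h1
    have := (((hasDerivAt_id' t).const_mul (f'' 0)).const_add (f' 0)).fun_add
      (((hasDerivAt_id' t).fun_pow 2).const_mul (c / 2))
    exact this.congr_deriv (by simp; ring)
  have h3 : ∀ t ∈ Set.Icc (0 : ℝ) 1,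
      f t ≤ f 0 + f' 0 * t + f'' 0 / 2 * t ^ 2 + c / 6 * t ^ 3 := by
    refine le_of_hasDerivAt_le (g' := fun t => f' 0 + f'' 0 * t + c / 2 * t ^ 2) hf
      (fun t => ?_) (by simp) h2
    have := ((((hasDerivAt_id' t).const_mul (f' 0)).const_add (f 0)).fun_add
      (((hasDerivAt_id' t).fun_pow 2).const_mul (f'' 0 / 2))).fun_add
      (((hasDerivAt_id' t).fun_pow 3).const_mul (c / 6))
    exact this.congr_deriv (by simp; ring)
  simpa using h3 1 (by simp)

end Taylor

theorem LamMaxLE.mono {ι : Type*} [Fintype ι] [DecidableEq ι] {A : Matrix ι ι ℝ} {K K' : ℝ}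
    (h : LamMaxLE A K) (hK : K ≤ K') : LamMaxLE A K' := fun μ hμ => (h μ hμ).trans hK

/-! ### Derivatives of `b`, also along lines. -/

section Smoothness

variable {b : ℝ → ℝ}

theorem hasDerivAt_of_contDiff_three (hb : ContDiff ℝ 3 b) (x : ℝ) :
    HasDerivAt b (deriv b x) x :=
  (hb.differentiable (by norm_num) x).hasDerivAt

theorem hasDerivAt_iteratedDeriv (hb : ContDiff ℝ 3 b) {k : ℕ} (hk : k < 3) (x : ℝ) :
    HasDerivAt (iteratedDeriv k b) (iteratedDeriv (k + 1) b x) x := by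
  rw [iteratedDeriv_succ]
  exact (hb.differentiable_iteratedDeriv k (by exact_mod_cast hk) x).hasDerivAt

theorem hasDerivAt_deriv (hb : ContDiff ℝ 3 b) (x : ℝ) :
    HasDerivAt (deriv b) (iteratedDeriv 2 b x) x := by
  have := hasDerivAt_iteratedDeriv hb (k := 1) (by norm_num) x
  rwa [iteratedDeriv_one] at this

theorem hasDerivAt_comp_line {g g' : ℝ → ℝ} (hg : ∀ x, HasDerivAt g (g' x) x) (x u t : ℝ) :
    HasDerivAt (fun t => g (x + t * u)) (g' (x + t * u) * u) t := by
  have h1 : HasDerivAt (fun t => x + t * u) u t := by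
    simpa using ((hasDerivAt_id' t).mul_const u).const_add x
  exact (hg _).comp t h1

theorem convexOn_of_iteratedDeriv_two (hb : ContDiff ℝ 3 b) (h : ∀ x, 0 ≤ iteratedDeriv 2 b x) :
    ConvexOn ℝ Set.univ b := by
  refine convexOn_univ_of_deriv2_nonneg (hb.differentiable (by norm_num))
    (fun x => (hasDerivAt_deriv hb x).differentiableAt) fun x => ?_
  rw [← iteratedDeriv_eq_iterate]
  exact h x

end Smoothness

/-! ### The loss near the true coefficient vector: deterministic bounds. -/

namespace Design

variable {n : ℕ} (D : Design n) {b : ℝ → ℝ}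

/-- The Euclidean norm of the coordinates in `M ∪ S`. -/
noncomputable def nrm (v : Fin D.p → ℝ) : ℝ := Real.sqrt (∑ j ∈ D.MS, v j ^ 2)

/-- The negative gradient of the loss at the true coefficient vector. -/
noncomputable def score (b : ℝ → ℝ) (y : Fin n → ℝ) (j : Fin D.p) : ℝ :=
  1 / (n : ℝ) * ∑ i, D.X i j * (y i - deriv b ((D.X *ᵥ D.βs) i))

theorem nrm_nonneg (v : Fin D.p → ℝ) : 0 ≤ D.nrm v := Real.sqrt_nonneg _

theorem nrm_sq (v : Fin D.p → ℝ) : D.nrm v ^ 2 = ∑ j ∈ D.MS, v j ^ 2 :=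
  Real.sq_sqrt (Finset.sum_nonneg fun _ _ => sq_nonneg _)

theorem nrm_smul (τ : ℝ) (v : Fin D.p → ℝ) : D.nrm (τ • v) = |τ| * D.nrm v := by
  simp only [nrm, Pi.smul_apply, smul_eq_mul, mul_pow, ← Finset.mul_sum]
  rw [Real.sqrt_mul (sq_nonneg _), Real.sqrt_sq_eq_abs]

theorem abs_le_nrm (v : Fin D.p → ℝ) {j : Fin D.p} (hj : j ∈ D.MS) : |v j| ≤ D.nrm v := by
  rw [← Real.sqrt_sq_eq_abs]
  exact Real.sqrt_le_sqrt (Finset.single_le_sum (f := fun j => v j ^ 2)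
    (fun _ _ => sq_nonneg _) hj)

theorem abs_sum_mul_le_nrm (u v : Fin D.p → ℝ) :
    |∑ j ∈ D.MS, u j * v j| ≤ D.nrm u * D.nrm v := by
  rw [← Real.sqrt_sq_eq_abs, nrm, nrm, ← Real.sqrt_mul (Finset.sum_nonneg fun _ _ => sq_nonneg _)]
  exact Real.sqrt_le_sqrt (Finset.sum_mul_sq_le_sq_mul_sq _ _ _)

theorem disjoint_M_S : Disjoint D.M D.S := by
  rw [Finset.disjoint_right]
  intro j hj
  exact (Finset.mem_filter.1 hj).2.1

theorem card_MS : (D.MS.card : ℝ) = (D.s : ℝ) + D.m := by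
  rw [MS, Finset.card_union_of_disjoint D.disjoint_M_S, s, m, Nat.cast_add, add_comm]

theorem sum_abs_le_nrm (v : Fin D.p → ℝ) :
    ∑ j ∈ D.MS, |v j| ≤ Real.sqrt ((D.s : ℝ) + D.m) * D.nrm v := by
  have h := D.abs_sum_mul_le_nrm (fun _ => 1) (fun j => |v j|)
  have h1 : D.nrm (fun _ => 1) = Real.sqrt ((D.s : ℝ) + D.m) := by
    simp [nrm, D.card_MS]
  have h2 : D.nrm (fun j => |v j|) = D.nrm v := by simp [nrm]
  rw [h1, h2] at h
  simpa using (le_abs_self _).trans h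

theorem βs_mem_fullFeasible : D.βs ∈ D.fullFeasible := by
  intro j hj
  by_contra h
  exact hj (Finset.mem_union.2 (by
    by_cases hM : j ∈ D.M
    · exact Or.inl hM
    · exact Or.inr (Finset.mem_filter.2 ⟨Finset.mem_univ _, hM, h⟩)))

variable {D}

theorem sub_mem_fullFeasible {u v : Fin D.p → ℝ} (hu : u ∈ D.fullFeasible)
    (hv : v ∈ D.fullFeasible) : u - v ∈ D.fullFeasible := fun j hj => by
  rw [Pi.sub_apply, hu j hj, hv j hj, sub_zero]

theorem smul_mem_fullFeasible {v : Fin D.p → ℝ} (τ : ℝ) (hv : v ∈ D.fullFeasible) :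
    τ • v ∈ D.fullFeasible := fun j hj => by
  rw [Pi.smul_apply, hv j hj, smul_zero]

theorem sum_eq_sum_MS {v : Fin D.p → ℝ} (hv : v ∈ D.fullFeasible) (w : Fin D.p → ℝ) :
    ∑ j, w j * v j = ∑ j ∈ D.MS, w j * v j :=
  (Finset.sum_subset (Finset.subset_univ _) fun j _ hj => by rw [hv j hj, mul_zero]).symm

theorem XMS_mulVec {v : Fin D.p → ℝ} (hv : v ∈ D.fullFeasible) :
    D.XMS *ᵥ (fun j : D.MS => v j) = D.X *ᵥ v := by
  funext i
  rw [Matrix.mulVec, Matrix.mulVec, dotProduct, dotProduct, sum_eq_sum_MS hv]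
  exact Finset.sum_coe_sort D.MS fun j => D.X i j * v j

theorem nrm_sq_subtype (v : Fin D.p → ℝ) : ∑ j : D.MS, v j ^ 2 = D.nrm v ^ 2 := by
  rw [nrm_sq]
  exact Finset.sum_coe_sort D.MS fun j => v j ^ 2

theorem quadForm_ge {v : Fin D.p → ℝ} (hv : v ∈ D.fullFeasible) {w : Fin n → ℝ} {K : ℝ}
    (h : LamMinGE (D.XMSᵀ * Matrix.diagonal w * D.XMS) K) :
    K * D.nrm v ^ 2 ≤ ∑ i, w i * (D.X *ᵥ v) i ^ 2 := by
  have := h.quadForm_le (isHermitian_gram_diagonal _ _) (fun j : D.MS => v j)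
  rwa [quadForm_gram_diagonal, XMS_mulVec hv, nrm_sq_subtype] at this

theorem quadForm_le {v : Fin D.p → ℝ} (hv : v ∈ D.fullFeasible) {w : Fin n → ℝ} {K : ℝ}
    (h : LamMaxLE (D.XMSᵀ * Matrix.diagonal w * D.XMS) K) :
    ∑ i, w i * (D.X *ᵥ v) i ^ 2 ≤ K * D.nrm v ^ 2 := by
  have := h.quadForm_le (isHermitian_gram_diagonal _ _) (fun j : D.MS => v j)
  rwa [quadForm_gram_diagonal, XMS_mulVec hv, nrm_sq_subtype] at this

theorem mulVec_line (β v : Fin D.p → ℝ) (t : ℝ) (i : Fin n) :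
    (D.X *ᵥ (β + t • v)) i = (D.X *ᵥ β) i + t * (D.X *ᵥ v) i := by
  rw [Matrix.mulVec_add, Matrix.mulVec_smul, Pi.add_apply, Pi.smul_apply, smul_eq_mul]

theorem add_smul_mem_N0 {v : Fin D.p → ℝ} (hv : v ∈ D.fullFeasible)
    (hr : D.nrm v ≤ Real.sqrt (((D.s : ℝ) + D.m) * Real.log n / n)) {t : ℝ}
    (ht : t ∈ Set.Icc (0 : ℝ) 1) : D.βs + t • v ∈ D.N0 := by
  refine ⟨?_, fun j hj => ?_⟩
  · have h1 : D.nrm (t • v) ≤ D.nrm v := by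
      rw [nrm_smul, abs_of_nonneg ht.1]
      exact mul_le_of_le_one_left (D.nrm_nonneg v) ht.2
    refine le_trans (le_of_eq ?_) (h1.trans hr)
    simp [nrm]
  · rw [Pi.add_apply, D.βs_mem_fullFeasible j hj, smul_mem_fullFeasible t hv j hj, add_zero]

theorem hasDerivAt_loss_line (hb : ContDiff ℝ 3 b) (y : Fin n → ℝ) (β v : Fin D.p → ℝ) (t : ℝ) :
    HasDerivAt (fun t : ℝ => D.loss b y (β + t • v))
      (-(1 / (n : ℝ)) * ∑ i, (y i - deriv b ((D.X *ᵥ β) i + t * (D.X *ᵥ v) i)) * (D.X *ᵥ v) i)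
      t := by
  simp only [loss, mulVec_line]
  refine HasDerivAt.const_mul _ (HasDerivAt.fun_sum fun i _ => ?_)
  have h1 := hasDerivAt_comp_line (hasDerivAt_of_contDiff_three hb) ((D.X *ᵥ β) i)
    ((D.X *ᵥ v) i) t
  have h2 := (hasDerivAt_comp_line (fun x => hasDerivAt_id' x) ((D.X *ᵥ β) i)
    ((D.X *ᵥ v) i) t).const_mul (y i)
  exact (h2.fun_sub h1).congr_deriv (by ring)

theorem hasDerivAt_loss_line_two (hb : ContDiff ℝ 3 b) (y : Fin n → ℝ) (β v : Fin D.p → ℝ)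
    (t : ℝ) :
    HasDerivAt (fun t : ℝ =>
      -(1 / (n : ℝ)) * ∑ i, (y i - deriv b ((D.X *ᵥ β) i + t * (D.X *ᵥ v) i)) * (D.X *ᵥ v) i)
      (1 / (n : ℝ) * ∑ i, iteratedDeriv 2 b ((D.X *ᵥ (β + t • v)) i) * (D.X *ᵥ v) i ^ 2) t := by
  have h : HasDerivAt (fun t : ℝ =>
      ∑ i, (y i - deriv b ((D.X *ᵥ β) i + t * (D.X *ᵥ v) i)) * (D.X *ᵥ v) i)
      (∑ i, -(iteratedDeriv 2 b ((D.X *ᵥ (β + t • v)) i) * (D.X *ᵥ v) i ^ 2)) t := by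
    refine HasDerivAt.fun_sum fun i _ => ?_
    refine (((hasDerivAt_comp_line (hasDerivAt_deriv hb) ((D.X *ᵥ β) i)
      ((D.X *ᵥ v) i) t).const_sub (y i)).mul_const ((D.X *ᵥ v) i)).congr_deriv ?_
    rw [mulVec_line]
    ring
  refine (h.const_mul (-(1 / (n : ℝ)))).congr_deriv ?_
  rw [Finset.sum_neg_distrib]
  ring

theorem hasDerivAt_loss_line_three (hb : ContDiff ℝ 3 b) (β v : Fin D.p → ℝ) (t : ℝ) :
    HasDerivAt (fun t : ℝ =>
      1 / (n : ℝ) * ∑ i, iteratedDeriv 2 b ((D.X *ᵥ (β + t • v)) i) * (D.X *ᵥ v) i ^ 2)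
      (1 / (n : ℝ) * ∑ i, iteratedDeriv 3 b ((D.X *ᵥ (β + t • v)) i) * (D.X *ᵥ v) i ^ 3) t := by
  simp only [mulVec_line]
  refine HasDerivAt.const_mul _ (HasDerivAt.fun_sum fun i _ => ?_)
  exact ((hasDerivAt_comp_line (hasDerivAt_iteratedDeriv hb (k := 2) (by norm_num))
    ((D.X *ᵥ β) i) ((D.X *ᵥ v) i) t).mul_const ((D.X *ᵥ v) i ^ 2)).congr_deriv (by ring)

theorem differentiable_loss (hb : ContDiff ℝ 3 b) (y : Fin n → ℝ) :
    Differentiable ℝ (D.loss b y) := by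
  have hb' : Differentiable ℝ b := hb.differentiable (by norm_num)
  unfold loss
  simp only [Matrix.mulVec, dotProduct]
  fun_prop

theorem grad_eq (hb : ContDiff ℝ 3 b) (y : Fin n → ℝ) (β : Fin D.p → ℝ) (j : Fin D.p) :
    D.grad b y β j = -(1 / (n : ℝ)) * ∑ i, D.X i j * (y i - deriv b ((D.X *ᵥ β) i)) := by
  rw [grad, ← (differentiable_loss hb y β).lineDeriv_eq_fderiv, lineDeriv,
    (hasDerivAt_loss_line hb y β _ 0).deriv]
  simp [mul_comm]

theorem sum_resid_mul (y : Fin n → ℝ) {v : Fin D.p → ℝ} (hv : v ∈ D.fullFeasible) :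
    1 / (n : ℝ) * ∑ i, (y i - deriv b ((D.X *ᵥ D.βs) i)) * (D.X *ᵥ v) i =
      ∑ j ∈ D.MS, D.score b y j * v j := by
  rw [← sum_eq_sum_MS hv]
  simp only [score, Matrix.mulVec, dotProduct, Finset.mul_sum, Finset.sum_mul]
  rw [Finset.sum_comm]
  exact Finset.sum_congr rfl fun j _ => Finset.sum_congr rfl fun i _ => by ring

/-- Second-order expansion along the segment from `β*` to `β* + v`, which stays in `N0`. The linear
term is minus the inner product of score and `v`, bounded by Cauchy–Schwarz. -/
theorem loss_lower_bound (hb : ContDiff ℝ 3 b) (hn : 0 < n) {κ : ℝ}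
    (hmin : ∀ β ∈ D.N0, LamMinGE (D.XMSᵀ * D.Sig b β * D.XMS) (κ * n)) (y : Fin n → ℝ)
    {v : Fin D.p → ℝ} (hv : v ∈ D.fullFeasible)
    (hr : D.nrm v ≤ Real.sqrt (((D.s : ℝ) + D.m) * Real.log n / n)) :
    D.loss b y D.βs - D.nrm (D.score b y) * D.nrm v + κ * D.nrm v ^ 2 / 2 ≤
      D.loss b y (D.βs + v) := by
  have hn' : (0 : ℝ) < n := Nat.cast_pos.2 hn
  have h := taylor_two_lower (c := κ * D.nrm v ^ 2) (hasDerivAt_loss_line hb y D.βs v)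
    (hasDerivAt_loss_line_two hb y D.βs v) fun t ht => by
      have h1 := quadForm_ge hv (hmin _ (add_smul_mem_N0 hv hr ht))
      rw [one_div, inv_mul_eq_div, le_div_iff₀ hn']
      linarith
  simp only [zero_smul, add_zero, one_smul, zero_mul, neg_mul] at h
  rw [sum_resid_mul y hv] at h
  have := (abs_le.1 (D.abs_sum_mul_le_nrm (D.score b y) v)).2
  linarith

/-- One of the three factors `(Xv)_i` is expanded over columns, so that the rest becomes, for each
column `j`, the quadratic form of `thirdDiag`. Passing from `∑ |v j|` to the Euclidean norm costs
the factor `√(s+m)`. -/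
theorem sum_third_le (hn : 0 < n) {K : ℝ} (hK : 0 ≤ K) {β : Fin D.p → ℝ}
    (h : ∀ j, LamMaxLE (D.XMSᵀ * D.thirdDiag b β j * D.XMS) (K * n))
    {v : Fin D.p → ℝ} (hv : v ∈ D.fullFeasible) :
    1 / (n : ℝ) * ∑ i, iteratedDeriv 3 b ((D.X *ᵥ β) i) * (D.X *ᵥ v) i ^ 3 ≤
      K * Real.sqrt ((D.s : ℝ) + D.m) * D.nrm v ^ 3 := by
  have hn' : (0 : ℝ) < n := Nat.cast_pos.2 hn
  rw [one_div, inv_mul_eq_div, div_le_iff₀ hn']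
  calc ∑ i, iteratedDeriv 3 b ((D.X *ᵥ β) i) * (D.X *ᵥ v) i ^ 3
      ≤ ∑ i, ∑ j ∈ D.MS, |v j| *
          (|D.X i j| * |iteratedDeriv 3 b ((D.X *ᵥ β) i)| * (D.X *ᵥ v) i ^ 2) := by
        refine Finset.sum_le_sum fun i _ => ?_
        have h1 : |(D.X *ᵥ v) i| ≤ ∑ j ∈ D.MS, |v j| * |D.X i j| := by
          rw [Matrix.mulVec, dotProduct, sum_eq_sum_MS hv]
          refine (Finset.abs_sum_le_sum_abs _ _).trans (le_of_eq ?_)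
          exact Finset.sum_congr rfl fun j _ => by rw [abs_mul, mul_comm]
        calc iteratedDeriv 3 b ((D.X *ᵥ β) i) * (D.X *ᵥ v) i ^ 3
            ≤ |iteratedDeriv 3 b ((D.X *ᵥ β) i) * (D.X *ᵥ v) i ^ 3| := le_abs_self _
          _ = |(D.X *ᵥ v) i| * (|iteratedDeriv 3 b ((D.X *ᵥ β) i)| * (D.X *ᵥ v) i ^ 2) := by
            rw [abs_mul, abs_pow, ← sq_abs ((D.X *ᵥ v) i)]; ring
          _ ≤ (∑ j ∈ D.MS, |v j| * |D.X i j|) *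
              (|iteratedDeriv 3 b ((D.X *ᵥ β) i)| * (D.X *ᵥ v) i ^ 2) :=
            mul_le_mul_of_nonneg_right h1 (by positivity)
          _ = _ := by
            rw [Finset.sum_mul]
            exact Finset.sum_congr rfl fun j _ => by ring
    _ = ∑ j ∈ D.MS, |v j| *
          ∑ i, |D.X i j| * |iteratedDeriv 3 b ((D.X *ᵥ β) i)| * (D.X *ᵥ v) i ^ 2 := by
        rw [Finset.sum_comm]
        exact Finset.sum_congr rfl fun j _ => (Finset.mul_sum _ _ _).symm
    _ ≤ ∑ j ∈ D.MS, |v j| * (K * n * D.nrm v ^ 2) :=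
        Finset.sum_le_sum fun j _ =>
          mul_le_mul_of_nonneg_left (quadForm_le hv (h j)) (abs_nonneg _)
    _ = (∑ j ∈ D.MS, |v j|) * (K * n * D.nrm v ^ 2) := (Finset.sum_mul _ _ _).symm
    _ ≤ (Real.sqrt ((D.s : ℝ) + D.m) * D.nrm v) * (K * n * D.nrm v ^ 2) :=
        mul_le_mul_of_nonneg_right (D.sum_abs_le_nrm v) (by positivity)
    _ = _ := by ring

theorem loss_upper_bound (hb : ContDiff ℝ 3 b) (hn : 0 < n) {K₂ K₃ : ℝ} (hK₃ : 0 ≤ K₃)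
    (hmax : LamMaxLE (D.XMSᵀ * D.Sig b D.βs * D.XMS) (K₂ * n))
    (hthird : ∀ β ∈ D.N0, ∀ j, LamMaxLE (D.XMSᵀ * D.thirdDiag b β j * D.XMS) (K₃ * n))
    (y : Fin n → ℝ) {v : Fin D.p → ℝ} (hv : v ∈ D.fullFeasible)
    (hr : D.nrm v ≤ Real.sqrt (((D.s : ℝ) + D.m) * Real.log n / n)) :
    D.loss b y (D.βs + v) ≤ D.loss b y D.βs + D.nrm (D.score b y) * D.nrm v +
      K₂ * D.nrm v ^ 2 / 2 + K₃ * Real.sqrt ((D.s : ℝ) + D.m) * D.nrm v ^ 3 / 6 := by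
  have hn' : (0 : ℝ) < n := Nat.cast_pos.2 hn
  have h := taylor_three_upper (hasDerivAt_loss_line hb y D.βs v)
    (hasDerivAt_loss_line_two hb y D.βs v) (hasDerivAt_loss_line_three hb D.βs v)
    fun t ht => sum_third_le hn hK₃ (hthird _ (add_smul_mem_N0 hv hr ht)) hv
  simp only [zero_smul, add_zero, one_smul, zero_mul, neg_mul] at h
  rw [sum_resid_mul y hv] at h
  have h1 := (abs_le.1 (D.abs_sum_mul_le_nrm (D.score b y) v)).1
  have h2 : 1 / (n : ℝ) * ∑ i, iteratedDeriv 2 b ((D.X *ᵥ D.βs) i) * (D.X *ᵥ v) i ^ 2 ≤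
      K₂ * D.nrm v ^ 2 := by
    have := quadForm_le hv hmax
    rw [one_div, inv_mul_eq_div, div_le_iff₀ hn']
    linarith
  linarith

theorem loss_line_le (hconv : ConvexOn ℝ Set.univ b) (y : Fin n → ℝ) (β v : Fin D.p → ℝ) {t : ℝ}
    (ht : t ∈ Set.Icc (0 : ℝ) 1) :
    D.loss b y (β + t • v) ≤ D.loss b y β + t * (D.loss b y (β + v) - D.loss b y β) := by
  have h1 : ∀ i, b ((D.X *ᵥ (β + t • v)) i) ≤
      (1 - t) * b ((D.X *ᵥ β) i) + t * b ((D.X *ᵥ (β + v)) i) := fun i => by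
    have := hconv.2 (Set.mem_univ ((D.X *ᵥ β) i)) (Set.mem_univ ((D.X *ᵥ (β + v)) i))
      (sub_nonneg.2 ht.2) ht.1 (by ring)
    simp only [smul_eq_mul] at this
    refine le_trans (le_of_eq ?_) this
    rw [mulVec_line, Matrix.mulVec_add, Pi.add_apply]
    congr 1
    ring
  have h2 : ∑ i, ((1 - t) * (y i * (D.X *ᵥ β) i - b ((D.X *ᵥ β) i)) +
      t * (y i * (D.X *ᵥ (β + v)) i - b ((D.X *ᵥ (β + v)) i))) ≤
      ∑ i, (y i * (D.X *ᵥ (β + t • v)) i - b ((D.X *ᵥ (β + t • v)) i)) := by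
    refine Finset.sum_le_sum fun i _ => ?_
    have h3 := h1 i
    have h4 : (D.X *ᵥ (β + t • v)) i = (D.X *ᵥ β) i + t * (D.X *ᵥ v) i := mulVec_line _ _ _ _
    have h5 : (D.X *ᵥ (β + v)) i = (D.X *ᵥ β) i + (D.X *ᵥ v) i := by
      rw [Matrix.mulVec_add, Pi.add_apply]
    have h6 : y i * (D.X *ᵥ (β + t • v)) i =
        (1 - t) * (y i * (D.X *ᵥ β) i) + t * (y i * (D.X *ᵥ (β + v)) i) := by
      rw [h4, h5]; ring
    linarith
  rw [Finset.sum_add_distrib, ← Finset.mul_sum, ← Finset.mul_sum] at h2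
  have h3 := mul_le_mul_of_nonneg_left h2 (by positivity : 0 ≤ 1 / (n : ℝ))
  simp only [loss]
  linarith

/-- If the point were farther than `R`, the segment from `β*` to it would cross the sphere of radius
`R`. By convexity the loss there exceeds that at `β*` by at most `U`, contradicting the quadratic
growth. -/
theorem nrm_sub_le_of_loss_le (hb : ContDiff ℝ 3 b) (hconv : ConvexOn ℝ Set.univ b) (hn : 0 < n)
    {κ : ℝ} (hmin : ∀ β ∈ D.N0, LamMinGE (D.XMSᵀ * D.Sig b β * D.XMS) (κ * n))
    (y : Fin n → ℝ) {β : Fin D.p → ℝ} (hβ : β ∈ D.fullFeasible) {U R : ℝ} (hU : 0 ≤ U)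
    (hR : 0 ≤ R) (hR' : R ≤ Real.sqrt (((D.s : ℝ) + D.m) * Real.log n / n))
    (hloss : D.loss b y β ≤ D.loss b y D.βs + U)
    (hUR : U + D.nrm (D.score b y) * R < κ * R ^ 2 / 2) : D.nrm (β - D.βs) ≤ R := by
  by_contra! hlt
  have hpos : 0 < D.nrm (β - D.βs) := hR.trans_lt hlt
  set v := β - D.βs with hv
  have hvf : v ∈ D.fullFeasible := sub_mem_fullFeasible hβ D.βs_mem_fullFeasible
  set τ := R / D.nrm v with hτ
  have hτm : τ ∈ Set.Icc (0 : ℝ) 1 := ⟨by positivity, (div_le_one hpos).2 hlt.le⟩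
  have hnτ : D.nrm (τ • v) = R := by
    rw [nrm_smul, abs_of_nonneg hτm.1, hτ, div_mul_cancel₀ _ hpos.ne']
  have h1 := loss_lower_bound hb hn hmin y (smul_mem_fullFeasible τ hvf) (hnτ ▸ hR')
  rw [hnτ] at h1
  have h2 := loss_line_le hconv y D.βs v hτm
  have h3 : D.βs + v = β := by rw [hv]; abel
  rw [h3] at h2
  have h4 : τ * (D.loss b y β - D.loss b y D.βs) ≤ U :=
    calc τ * (D.loss b y β - D.loss b y D.βs) ≤ τ * U :=
          mul_le_mul_of_nonneg_left (by linarith) hτm.1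
      _ ≤ U := mul_le_of_le_one_left hU hτm.2
  linarith

/-- Duality of row sum and sup norm; each coordinate of `v` in `M ∪ S` is at most its Euclidean
norm. -/
theorem abs_cross_le {K : ℝ} (j : {j : Fin D.p // j ∉ D.MS})
    (h : ∑ k, |(D.XMScᵀ * D.Sig b D.βs * D.XMS) j k| ≤ K)
    {v : Fin D.p → ℝ} (hv : v ∈ D.fullFeasible) :
    |∑ i, D.X i j * (iteratedDeriv 2 b ((D.X *ᵥ D.βs) i) * (D.X *ᵥ v) i)| ≤ K * D.nrm v := by
  have h1 : ∑ i, D.X i j * (iteratedDeriv 2 b ((D.X *ᵥ D.βs) i) * (D.X *ᵥ v) i) =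
      ∑ k : D.MS, (D.XMScᵀ * D.Sig b D.βs * D.XMS) j k * v k := by
    have : ((D.XMScᵀ * D.Sig b D.βs * D.XMS) *ᵥ fun k : D.MS => v k) j =
        (D.XMScᵀ *ᵥ (D.Sig b D.βs *ᵥ (D.X *ᵥ v))) j := by
      rw [← Matrix.mulVec_mulVec, ← Matrix.mulVec_mulVec, XMS_mulVec hv]
    simp only [Sig, Matrix.mulVec, dotProduct, Matrix.diagonal_apply, ite_mul, zero_mul,
      Finset.sum_ite_eq, Finset.mem_univ, if_true] at this
    exact this.symm
  rw [h1]
  calc |∑ k : D.MS, (D.XMScᵀ * D.Sig b D.βs * D.XMS) j k * v k|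
      ≤ ∑ k : D.MS, |(D.XMScᵀ * D.Sig b D.βs * D.XMS) j k| * D.nrm v := by
        refine (Finset.abs_sum_le_sum_abs _ _).trans (Finset.sum_le_sum fun k _ => ?_)
        rw [abs_mul]
        exact mul_le_mul_of_nonneg_left (D.abs_le_nrm v k.2) (abs_nonneg _)
    _ = (∑ k : D.MS, |(D.XMScᵀ * D.Sig b D.βs * D.XMS) j k|) * D.nrm v :=
        (Finset.sum_mul _ _ _).symm
    _ ≤ K * D.nrm v := mul_le_mul_of_nonneg_right h (D.nrm_nonneg v)

/-- Expansion of a single gradient coordinate about `β*`: the first-order term is a row of the cross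
Hessian, and the second-order remainder is dominated by the quadratic form of `thirdDiag` for this
same `j`, so no factor `√(s+m)` appears. -/
theorem abs_grad_le (hb : ContDiff ℝ 3 b) (hn : 0 < n) {K₃ K₄ : ℝ}
    (hthird : ∀ β ∈ D.N0, ∀ j, LamMaxLE (D.XMSᵀ * D.thirdDiag b β j * D.XMS) (K₃ * n))
    (hcross : ∀ j, ∑ k, |(D.XMScᵀ * D.Sig b D.βs * D.XMS) j k| ≤ K₄ * n)
    (y : Fin n → ℝ) {β : Fin D.p → ℝ} (hβ : β ∈ D.fullFeasible)
    (hr : D.nrm (β - D.βs) ≤ Real.sqrt (((D.s : ℝ) + D.m) * Real.log n / n))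
    {j : Fin D.p} (hj : j ∉ D.MS) :
    |D.grad b y β j| ≤ |D.score b y j| + K₄ * D.nrm (β - D.βs) +
      K₃ * D.nrm (β - D.βs) ^ 2 / 2 := by
  have hn' : (0 : ℝ) < n := Nat.cast_pos.2 hn
  set v := β - D.βs with hvdef
  have hv : v ∈ D.fullFeasible := sub_mem_fullFeasible hβ D.βs_mem_fullFeasible
  have hβv : β = D.βs + v := by rw [hvdef]; abel
  have hd1 : ∀ t, HasDerivAt
      (fun t => 1 / (n : ℝ) * ∑ i, D.X i j * deriv b ((D.X *ᵥ D.βs) i + t * (D.X *ᵥ v) i))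
      (1 / (n : ℝ) * ∑ i, D.X i j *
        (iteratedDeriv 2 b ((D.X *ᵥ D.βs) i + t * (D.X *ᵥ v) i) * (D.X *ᵥ v) i)) t := fun t =>
    HasDerivAt.const_mul _ (HasDerivAt.fun_sum fun i _ =>
      (hasDerivAt_comp_line (hasDerivAt_deriv hb) _ _ t).const_mul _)
  have hd2 : ∀ t, HasDerivAt (fun t => 1 / (n : ℝ) * ∑ i, D.X i j *
        (iteratedDeriv 2 b ((D.X *ᵥ D.βs) i + t * (D.X *ᵥ v) i) * (D.X *ᵥ v) i))
      (1 / (n : ℝ) * ∑ i, D.X i j *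
        (iteratedDeriv 3 b ((D.X *ᵥ D.βs) i + t * (D.X *ᵥ v) i) * (D.X *ᵥ v) i *
          (D.X *ᵥ v) i)) t := fun t =>
    HasDerivAt.const_mul _ (HasDerivAt.fun_sum fun i _ =>
      ((hasDerivAt_comp_line (hasDerivAt_iteratedDeriv hb (k := 2) (by norm_num)) _ _
        t).mul_const _).const_mul _)
  have htay := abs_taylor_two_le (c := K₃ * D.nrm v ^ 2) hd1 hd2 fun t ht => by
    have h1 := quadForm_le hv (hthird _ (add_smul_mem_N0 hv hr ht) j)
    rw [abs_mul, abs_of_pos (by positivity : 0 < 1 / (n : ℝ)), one_div, inv_mul_eq_div,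
      div_le_iff₀ hn']
    refine (Finset.abs_sum_le_sum_abs _ _).trans (le_trans (le_of_eq ?_) (h1.trans_eq (by ring)))
    refine Finset.sum_congr rfl fun i _ => ?_
    rw [mulVec_line, abs_mul, abs_mul, abs_mul, ← sq_abs ((D.X *ᵥ v) i)]
    ring
  simp only [zero_mul, add_zero, one_mul] at htay
  have hc := abs_cross_le ⟨j, hj⟩ (hcross ⟨j, hj⟩) hv
  have hc' : |1 / (n : ℝ) * ∑ i, D.X i j *
      (iteratedDeriv 2 b ((D.X *ᵥ D.βs) i) * (D.X *ᵥ v) i)| ≤ K₄ * D.nrm v := by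
    rw [abs_mul, abs_of_pos (by positivity : 0 < 1 / (n : ℝ)), one_div, inv_mul_eq_div,
      div_le_iff₀ hn']
    exact hc.trans_eq (by ring)
  have hgrad : D.grad b y β j = -D.score b y j +
      (1 / (n : ℝ) * ∑ i, D.X i j * deriv b ((D.X *ᵥ D.βs) i + (D.X *ᵥ v) i) -
        1 / (n : ℝ) * ∑ i, D.X i j * deriv b ((D.X *ᵥ D.βs) i)) := by
    rw [grad_eq hb, hβv, score, Matrix.mulVec_add]
    simp only [mul_sub, Finset.sum_sub_distrib, Pi.add_apply]
    ring
  rw [hgrad]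
  rw [abs_le] at htay hc' ⊢
  have := neg_abs_le (D.score b y j)
  have := le_abs_self (D.score b y j)
  constructor <;> linarith

theorem nrm_eq_zero_of_card (h : (D.s : ℝ) + D.m = 0) (v : Fin D.p → ℝ) : D.nrm v = 0 := by
  have h1 : D.MS = ∅ := by
    rw [← Finset.card_eq_zero]
    exact_mod_cast D.card_MS.trans h
  simp [nrm, h1]

/-- A vector supported in `M ∪ S` whose loss does not exceed the loss of a point close to the
true coefficient vector is itself close to the true coefficient vector. -/
theorem nrm_sub_le_of_score_le (hb : ContDiff ℝ 3 b) (hconv : ConvexOn ℝ Set.univ b) (hn : 0 < n)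
    {κ K₂ K₃ A c : ℝ} (hK₂ : 0 ≤ K₂) (hK₃ : 0 ≤ K₃) (hc : 0 ≤ c) (hcA : c ≤ A)
    (hA : (K₂ / 2 + K₃ / 6) * c ^ 2 < κ * A ^ 2 / 4)
    (hmin : ∀ β ∈ D.N0, LamMinGE (D.XMSᵀ * D.Sig b β * D.XMS) (κ * n))
    (hmax : LamMaxLE (D.XMSᵀ * D.Sig b D.βs * D.XMS) (K₂ * n))
    (hthird : ∀ β ∈ D.N0, ∀ j, LamMaxLE (D.XMSᵀ * D.thirdDiag b β j * D.XMS) (K₃ * n))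
    (hlog : A ^ 2 ≤ Real.log n) (hsm : c * ((D.s : ℝ) + D.m) ≤ Real.sqrt n)
    (y : Fin n → ℝ) {β β' : Fin D.p → ℝ} (hβ : β ∈ D.fullFeasible) (hβ' : β' ∈ D.fullFeasible)
    (hnear : D.nrm (β' - D.βs) ≤ c * Real.sqrt (((D.s : ℝ) + D.m) / n))
    (hloss : D.loss b y β ≤ D.loss b y β')
    (hscore : D.nrm (D.score b y) ≤ κ * A / 8 * Real.sqrt (((D.s : ℝ) + D.m) / n)) :
    D.nrm (β - D.βs) ≤ A * Real.sqrt (((D.s : ℝ) + D.m) / n) := by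
  have hn' : (0 : ℝ) < n := Nat.cast_pos.2 hn
  have hA0 : 0 ≤ A := hc.trans hcA
  have hk0 : 0 ≤ (D.s : ℝ) + D.m := by positivity
  -- When `M ∪ S` is empty the radius is zero and the strict inequality needed below would fail, so
  -- this case is separate.
  rcases hk0.eq_or_lt with hk | hk
  · rw [nrm_eq_zero_of_card hk.symm]
    positivity
  set q := Real.sqrt (((D.s : ℝ) + D.m) / n) with hq
  have hqpos : 0 < q := Real.sqrt_pos.2 (by positivity)
  have hrad : A * q ≤ Real.sqrt (((D.s : ℝ) + D.m) * Real.log n / n) := by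
    refine Real.le_sqrt_of_sq_le ?_
    rw [mul_pow, hq, Real.sq_sqrt (by positivity), mul_div_assoc', mul_comm (A ^ 2)]
    gcongr
  set δ := D.nrm (β' - D.βs) with hδ
  have hδ0 : 0 ≤ δ := D.nrm_nonneg _
  have hδA : δ ≤ A * q := hnear.trans (by gcongr)
  set G := D.nrm (D.score b y) with hG
  have hG0 : 0 ≤ G := D.nrm_nonneg _
  have hup := loss_upper_bound hb hn hK₃ hmax hthird y
    (sub_mem_fullFeasible hβ' D.βs_mem_fullFeasible) (hδA.trans hrad)
  rw [add_sub_cancel, ← hδ, ← hG] at hup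
  -- This absorbs the factor `√(s+m)` of the cubic remainder, leaving a term quadratic in `δ`.
  have hroot : Real.sqrt ((D.s : ℝ) + D.m) * δ ≤ 1 := by
    calc Real.sqrt ((D.s : ℝ) + D.m) * δ ≤ Real.sqrt ((D.s : ℝ) + D.m) * (c * q) := by gcongr
      _ = c * ((D.s : ℝ) + D.m) / Real.sqrt n := by
        rw [hq, Real.sqrt_div hk0]
        nth_rw 3 [← Real.mul_self_sqrt hk0]
        ring
      _ ≤ 1 := (div_le_one (Real.sqrt_pos.2 hn')).2 hsm
  have hδc : δ ^ 2 ≤ c ^ 2 * q ^ 2 := by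
    rw [← mul_pow]
    exact pow_le_pow_left₀ hδ0 hnear 2
  have hU : D.loss b y β ≤
      D.loss b y D.βs + (G * (A * q) + (K₂ / 2 + K₃ / 6) * (c ^ 2 * q ^ 2)) := by
    have h1 : K₃ * Real.sqrt ((D.s : ℝ) + D.m) * δ ^ 3 / 6 ≤ K₃ / 6 * δ ^ 2 := by
      have := mul_le_mul_of_nonneg_left hroot (by positivity : 0 ≤ K₃ / 6 * δ ^ 2)
      linarith
    have h2 : (K₂ / 2 + K₃ / 6) * δ ^ 2 ≤ (K₂ / 2 + K₃ / 6) * (c ^ 2 * q ^ 2) := by gcongr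
    have h3 : G * δ ≤ G * (A * q) := by gcongr
    linarith
  refine nrm_sub_le_of_loss_le hb hconv hn hmin y hβ (by positivity) (by positivity) hrad hU ?_
  -- The score enters twice, through `U` and through the lower bound, costing `κA²q²/8` each; `hA`
  -- bounds the rest of `U` by the remaining `κA²q²/4`.
  have h1 : G * (A * q) ≤ κ * A / 8 * q * (A * q) := by gcongr
  have h2 := mul_lt_mul_of_pos_right hA (by positivity : 0 < q ^ 2)
  linarith

/-- Some vector supported in `M ∪ S` satisfies the constraints and lies within a multiple of
`‖h‖` of the true coefficient vector. -/
theorem exists_reducedFeasible_near (hrank : D.C.rank = D.r) {K : ℝ} (hK : 0 ≤ K)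
    (hC : LamMaxLE (D.C * D.Cᵀ)⁻¹ K) :
    ∃ β ∈ D.reducedFeasible, D.nrm (β - D.βs) ≤ Real.sqrt K * D.hNorm := by
  classical
  have hu : IsUnit (D.C * D.Cᵀ) := by
    rw [← Matrix.mulVec_surjective_iff_isUnit]
    have h1 : (D.C * D.Cᵀ).rank = D.r := by rw [Matrix.rank_self_mul_transpose, hrank]
    have h2 : LinearMap.range (D.C * D.Cᵀ).mulVecLin = ⊤ :=
      Submodule.eq_top_of_finrank_eq (by rw [← Matrix.rank, h1, Module.finrank_fin_fun])
    exact LinearMap.range_eq_top.1 h2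
  have hdet : IsUnit (D.C * D.Cᵀ).det := (Matrix.isUnit_iff_isUnit_det _).1 hu
  have hherm : ((D.C * D.Cᵀ)⁻¹).IsHermitian := by
    have h1 : (D.C * D.Cᵀ).IsHermitian := by
      simpa using Matrix.isHermitian_mul_conjTranspose_self D.C
    exact h1.inv
  -- The least-norm solution of `C d = h` is `d = C'w`, with `‖d‖² = h'(CC')⁻¹h`; it is extended by
  -- zero outside `M`.
  set w : Fin D.r → ℝ := (D.C * D.Cᵀ)⁻¹ *ᵥ D.h with hw
  have hCw : D.C *ᵥ (D.Cᵀ *ᵥ w) = D.h := by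
    rw [Matrix.mulVec_mulVec, hw, Matrix.mulVec_mulVec, Matrix.mul_nonsing_inv _ hdet,
      Matrix.one_mulVec]
  set d : Fin D.p → ℝ := fun j => if hj : j ∈ D.M then (D.Cᵀ *ᵥ w) ⟨j, hj⟩ else 0 with hd
  have hdM : (fun j : D.M => d j) = D.Cᵀ *ᵥ w := by
    funext j
    simp [hd]
  refine ⟨D.βs - d, ⟨fun j hj => ?_, ?_⟩, ?_⟩
  · have : j ∉ D.M := fun h => hj (Finset.mem_union_left _ h)
    simp [hd, this, D.βs_mem_fullFeasible j hj]
  · have h1 : (fun j : D.M => (D.βs - d) j) = (fun j : D.M => D.βs j) - fun j : D.M => d j := rfl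
    have h2 : D.h = D.C *ᵥ (fun j : D.M => D.βs j) - D.t := rfl
    rw [constr, h1, Matrix.mulVec_sub, hdM, hCw, h2]
    abel
  · rw [nrm, hNorm, ← Real.sqrt_mul hK]
    refine Real.sqrt_le_sqrt ?_
    have h1 : ∑ j ∈ D.MS, (D.βs - d - D.βs) j ^ 2 = ∑ j ∈ D.M, d j ^ 2 := by
      rw [MS, Finset.sum_union D.disjoint_M_S, Finset.sum_eq_zero (s := D.S), add_zero]
      · exact Finset.sum_congr rfl fun j _ => by simp
      · intro j hj
        have : j ∉ D.M := (Finset.mem_filter.1 hj).2.1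
        simp [hd, this]
    have h2 : ∑ j ∈ D.M, d j ^ 2 = (D.Cᵀ *ᵥ w) ⬝ᵥ (D.Cᵀ *ᵥ w) := by
      rw [← hdM, dotProduct, ← Finset.sum_coe_sort]
      exact Finset.sum_congr rfl fun j _ => sq _
    rw [h1, h2, Matrix.dotProduct_mulVec, Matrix.vecMul_transpose, hCw, hw]
    exact hC.quadForm_le hherm D.h

end Design

/-! ### Moment bounds and tail inequalities for weighted sums of independent variables. -/

section Moments

variable {Ω : Type*} [MeasurableSpace Ω] {P : Measure Ω}

/-- In the power series, `s ^ k ≤ s ^ 2` for `k ≥ 2`. The proof instead differentiates along `t * x`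
and uses convexity of the exponential. -/
theorem exp_mul_sub_le {x s : ℝ} (hx : 0 ≤ x) (hs : 0 ≤ s) (hs1 : s ≤ 1) :
    Real.exp (s * x) - 1 - s * x ≤ s ^ 2 * (Real.exp x - 1 - x) := by
  have hf : ∀ t : ℝ, HasDerivAt (fun t => Real.exp (s * (t * x)) - 1 - s * (t * x))
      (s * x * (Real.exp (s * (t * x)) - 1)) t := fun t => by
    have h1 : HasDerivAt (fun t : ℝ => s * (t * x)) (s * x) t :=
      (((hasDerivAt_id' t).mul_const x).const_mul s).congr_deriv (by ring)
    exact ((h1.exp.sub_const 1).fun_sub h1).congr_deriv (by ring)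
  have hg : ∀ t : ℝ, HasDerivAt (fun t => s ^ 2 * (Real.exp (t * x) - 1 - t * x))
      (s ^ 2 * (x * (Real.exp (t * x) - 1))) t := fun t => by
    have h1 : HasDerivAt (fun t : ℝ => t * x) x t :=
      ((hasDerivAt_id' t).mul_const x).congr_deriv (by ring)
    exact (((h1.exp.sub_const 1).fun_sub h1).const_mul (s ^ 2)).congr_deriv (by ring)
  have hconv : ∀ t : ℝ, Real.exp (s * t) - 1 ≤ s * (Real.exp t - 1) := fun t => by
    have := convexOn_exp.2 (Set.mem_univ (0 : ℝ)) (Set.mem_univ t) (sub_nonneg.2 hs1) hs (by ring)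
    simp only [smul_eq_mul, mul_zero, zero_add, Real.exp_zero, mul_one] at this
    linarith
  have := le_of_hasDerivAt_le hf hg (by simp) (fun t _ => by
    have := mul_le_mul_of_nonneg_left (hconv (t * x)) (mul_nonneg hs hx)
    exact this.trans_eq (by ring)) 1 (by simp)
  simpa using this

theorem memLp_two_of_expMoment {e : Ω → ℝ} (hm : Measurable e) {K v₀ : ℝ} (hK : 0 < K)
    (hint : Integrable (fun ω => Real.exp (|e ω| / K) - 1 - |e ω| / K) P)
    (hv : (∫ ω, (Real.exp (|e ω| / K) - 1 - |e ω| / K) ∂P) * K ^ 2 ≤ v₀ / 2) :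
    MemLp e 2 P ∧ ∫ ω, e ω ^ 2 ∂P ≤ v₀ := by
  have hle : ∀ ω, e ω ^ 2 ≤ 2 * K ^ 2 * (Real.exp (|e ω| / K) - 1 - |e ω| / K) := fun ω => by
    have h1 := Real.quadratic_le_exp_of_nonneg (x := |e ω| / K) (by positivity)
    have h2 : e ω ^ 2 = 2 * K ^ 2 * ((|e ω| / K) ^ 2 / 2) := by
      rw [div_pow, sq_abs]; field_simp
    rw [h2]
    exact mul_le_mul_of_nonneg_left (by linarith) (by positivity)
  have hint2 : Integrable (fun ω => e ω ^ 2) P :=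
    (hint.const_mul (2 * K ^ 2)).mono' (by fun_prop) (ae_of_all _ fun ω => by
      rw [Real.norm_of_nonneg (sq_nonneg _)]; exact hle ω)
  refine ⟨(memLp_two_iff_integrable_sq hm.aestronglyMeasurable).2 hint2, ?_⟩
  calc ∫ ω, e ω ^ 2 ∂P ≤ ∫ ω, 2 * K ^ 2 * (Real.exp (|e ω| / K) - 1 - |e ω| / K) ∂P :=
        integral_mono hint2 (hint.const_mul _) hle
    _ = 2 * ((∫ ω, (Real.exp (|e ω| / K) - 1 - |e ω| / K) ∂P) * K ^ 2) := by
        rw [integral_const_mul]; ring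
    _ ≤ v₀ := by linarith

/-- Sub-Gaussian behaviour in the range `|t| ≤ 1/K`: centring removes the linear term and the
scaling inequality `exp_mul_sub_le` bounds the rest by `t² v₀/2`. -/
theorem mgf_le_of_expMoment [IsProbabilityMeasure P] {e : Ω → ℝ} (hm : Measurable e)
    (hei : Integrable e P) (he0 : ∫ ω, e ω ∂P = 0) {K v₀ : ℝ} (hK : 0 < K)
    (hint : Integrable (fun ω => Real.exp (|e ω| / K) - 1 - |e ω| / K) P)
    (hv : (∫ ω, (Real.exp (|e ω| / K) - 1 - |e ω| / K) ∂P) * K ^ 2 ≤ v₀ / 2)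
    {t : ℝ} (ht : |t| * K ≤ 1) :
    Integrable (fun ω => Real.exp (t * e ω)) P ∧ mgf e P t ≤ Real.exp (t ^ 2 * (v₀ / 2)) := by
  have hle : ∀ ω, Real.exp (t * e ω) ≤
      1 + t * e ω + (t * K) ^ 2 * (Real.exp (|e ω| / K) - 1 - |e ω| / K) := fun ω => by
    have h1 := exp_mul_sub_le (x := |e ω| / K) (s := |t| * K) (by positivity) (by positivity) ht
    have h2 : |t| * K * (|e ω| / K) = |t * e ω| := by
      rw [abs_mul]; field_simp
    have h3 : (|t| * K) ^ 2 = (t * K) ^ 2 := by rw [mul_pow, mul_pow, sq_abs]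
    rw [h2, h3] at h1
    -- For a negative argument this is `u ≤ sinh u` at `u = -(t * e ω)`.
    have h4 : Real.exp (t * e ω) - t * e ω ≤ Real.exp |t * e ω| - |t * e ω| := by
      rcases le_total 0 (t * e ω) with h | h
      · rw [abs_of_nonneg h]
      · rw [abs_of_nonpos h]
        have := Real.self_le_sinh_iff.2 (neg_nonneg.2 h)
        rw [Real.sinh_eq, neg_neg] at this
        linarith
    linarith
  have hint' : Integrable (fun ω => 1 + t * e ω +
      (t * K) ^ 2 * (Real.exp (|e ω| / K) - 1 - |e ω| / K)) P :=
    ((integrable_const _).add (hei.const_mul t)).add (hint.const_mul _)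
  have hi : Integrable (fun ω => Real.exp (t * e ω)) P :=
    hint'.mono' (by fun_prop) (ae_of_all _ fun ω => by
      rw [Real.norm_of_nonneg (Real.exp_nonneg _)]; exact hle ω)
  refine ⟨hi, (integral_mono hi hint' hle).trans ?_⟩
  have h1t : Integrable (fun ω => 1 + t * e ω) P := (integrable_const _).add (hei.const_mul t)
  rw [integral_add h1t (hint.const_mul _), integral_add (integrable_const _) (hei.const_mul t),
    integral_const_mul, integral_const_mul, he0]
  simp only [integral_const, probReal_univ, smul_eq_mul, mul_one, mul_zero, add_zero]
  have h1 := Real.add_one_le_exp (t ^ 2 * (v₀ / 2))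
  have h2 := mul_le_mul_of_nonneg_left hv (sq_nonneg t)
  rw [mul_pow]
  linarith

variable {n : ℕ} {e : Fin n → Ω → ℝ}

theorem integral_sq_weighted_sum_le [IsProbabilityMeasure P] (hind : iIndepFun e P)
    (hL : ∀ i, MemLp (e i) 2 P)
    (h0 : ∀ i, ∫ ω, e i ω ∂P = 0) {v₀ : ℝ} (hv : ∀ i, ∫ ω, e i ω ^ 2 ∂P ≤ v₀) (w : Fin n → ℝ) :
    Integrable (fun ω => (∑ i, w i * e i ω) ^ 2) P ∧
      ∫ ω, (∑ i, w i * e i ω) ^ 2 ∂P ≤ v₀ * ∑ i, w i ^ 2 := by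
  have hL' : ∀ i, MemLp (fun ω => w i * e i ω) 2 P := fun i => (hL i).const_mul (w i)
  have hsum : MemLp (fun ω => ∑ i, w i * e i ω) 2 P := memLp_finsetSum _ fun i _ => hL' i
  refine ⟨hsum.integrable_sq, ?_⟩
  have hmean : ∫ ω, ∑ i, w i * e i ω ∂P = 0 := by
    rw [integral_finsetSum _ fun i _ => (hL' i).integrable (by norm_num)]
    simp [integral_const_mul, h0]
  have hvar := IndepFun.variance_sum (s := Finset.univ) (X := fun i ω => w i * e i ω) (μ := P)
    (fun i _ => hL' i) fun i _ j _ hij =>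
      (hind.indepFun hij).comp (φ := fun x => w i * x) (ψ := fun x => w j * x)
        (by fun_prop) (by fun_prop)
  have h1 : variance (∑ i, fun ω => w i * e i ω) P = ∫ ω, (∑ i, w i * e i ω) ^ 2 ∂P := by
    have h2 : (∑ i, fun ω => w i * e i ω) = fun ω => ∑ i, w i * e i ω := by
      funext ω; simp
    rw [h2, variance_of_integral_eq_zero hsum.aestronglyMeasurable.aemeasurable hmean]
  rw [← h1, hvar, Finset.mul_sum]
  refine Finset.sum_le_sum fun i _ => ?_
  rw [variance_const_mul, variance_of_integral_eq_zero (hL i).aestronglyMeasurable.aemeasurable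
    (h0 i), mul_comm]
  exact mul_le_mul_of_nonneg_right (hv i) (sq_nonneg _)

/-- Chernoff bound; `hw` keeps every `t * w i` in the range where the moment generating function is
controlled. -/
theorem measure_weighted_sum_ge_le [IsProbabilityMeasure P] (hind : iIndepFun e P)
    (hm : ∀ i, Measurable (e i))
    {K v₀ : ℝ} (hmgf : ∀ i, ∀ t : ℝ, |t| * K ≤ 1 →
      Integrable (fun ω => Real.exp (t * e i ω)) P ∧ mgf (e i) P t ≤ Real.exp (t ^ 2 * (v₀ / 2)))
    (w : Fin n → ℝ) {t : ℝ} (ht : 0 ≤ t) (hw : ∀ i, t * |w i| * K ≤ 1) (u : ℝ) :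
    P.real {ω | u ≤ ∑ i, w i * e i ω} ≤
      Real.exp (-t * u + t ^ 2 * (v₀ / 2) * ∑ i, w i ^ 2) := by
  have hind' : iIndepFun (fun i ω => w i * e i ω) P :=
    hind.comp (fun i x => w i * x) fun i => by fun_prop
  have hb : ∀ i, Integrable (fun ω => Real.exp (t * (w i * e i ω))) P ∧
      mgf (fun ω => w i * e i ω) P t ≤ Real.exp ((t * w i) ^ 2 * (v₀ / 2)) := fun i => by
    have h1 := hmgf i (t * w i) (by rw [abs_mul, abs_of_nonneg ht]; exact hw i)
    simp only [mgf, ← mul_assoc] at h1 ⊢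
    exact h1
  have hsum : (∑ i, fun ω => w i * e i ω) = fun ω => ∑ i, w i * e i ω := by
    funext ω; simp
  have hint : Integrable (fun ω => Real.exp (t * ∑ i, w i * e i ω)) P := by
    have := hind'.integrable_exp_mul_sum (t := t) (fun i => (hm i).const_mul (w i))
      (s := Finset.univ) fun i _ => (hb i).1
    rwa [hsum] at this
  refine (measure_ge_le_exp_mul_mgf u ht hint).trans ?_
  rw [Real.exp_add]
  refine mul_le_mul_of_nonneg_left ?_ (Real.exp_nonneg _)
  rw [← hsum, hind'.mgf_sum (fun i => (hm i).const_mul (w i)) Finset.univ, Finset.mul_sum,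
    Real.exp_sum]
  refine Finset.prod_le_prod (fun i _ => mgf_nonneg) fun i _ => ((hb i).2).trans (le_of_eq ?_)
  congr 1
  ring

end Moments

/-! ### Tail bounds for the score. -/

namespace Design

variable {ν : Measure ℝ} {b c : ℝ → ℝ} {φ : ℝ} {n : ℕ} {D : Design n}
  {Ω : Type*} [MeasurableSpace Ω] {P : Measure Ω} {y : Ω → Fin n → ℝ}

/-- The centred response. -/
noncomputable def resid {Ω : Type*} (D : Design n) (b : ℝ → ℝ) (y : Ω → Fin n → ℝ)
    (i : Fin n) (ω : Ω) : ℝ :=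
  y ω i - deriv b ((D.X *ᵥ D.βs) i)

theorem IsSample.measurable_resid (hy : D.IsSample ν b c φ P y) (i : Fin n) :
    Measurable (D.resid b y i) := (hy.measurable i).sub_const _

theorem IsSample.iIndepFun_resid (hy : D.IsSample ν b c φ P y) :
    iIndepFun (fun i => D.resid b y i) P :=
  hy.indep.comp (fun i x => x - deriv b ((D.X *ᵥ D.βs) i)) fun i => by fun_prop

theorem IsSample.integrable_resid [IsProbabilityMeasure P] (hy : D.IsSample ν b c φ P y)
    (h : IsExponentialFamily ν b c φ) (i : Fin n) : Integrable (D.resid b y i) P :=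
  (hy.integrable h i).sub (integrable_const _)

theorem IsSample.integral_resid [IsProbabilityMeasure P] (hy : D.IsSample ν b c φ P y)
    (h : IsExponentialFamily ν b c φ) (i : Fin n) : ∫ ω, D.resid b y i ω ∂P = 0 := by
  simp only [resid]
  rw [integral_sub (hy.integrable h i) (integrable_const _), hy.integral_eq h]
  simp

theorem score_eq {Ω : Type*} (y : Ω → Fin n → ℝ) (j : Fin D.p) (ω : Ω) :
    D.score b (y ω) j = 1 / (n : ℝ) * ∑ i, D.X i j * D.resid b y i ω := rfl

/-- Markov's inequality for the squared norm: each of the `s + m` coordinates has second moment at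
most `v₀B/n`. -/
theorem IsSample.measure_nrm_score_le [IsProbabilityMeasure P] (hy : D.IsSample ν b c φ P y)
    (h : IsExponentialFamily ν b c φ) (hn : 0 < n) {K v₀ B : ℝ} (hK : 0 < K) (hv₀ : 0 ≤ v₀)
    (hmom : ∀ i, Integrable
        (fun ω => Real.exp (|D.resid b y i ω| / K) - 1 - |D.resid b y i ω| / K) P ∧
      (∫ ω, (Real.exp (|D.resid b y i ω| / K) - 1 - |D.resid b y i ω| / K) ∂P) * K ^ 2 ≤ v₀ / 2)
    (hB : ∀ j, ∑ i, D.X i j ^ 2 ≤ B * n) {z : ℝ} (hz : 0 < z) :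
    P {ω | z * Real.sqrt (((D.s : ℝ) + D.m) / n) < D.nrm (D.score b (y ω))} ≤
      ENNReal.ofReal (v₀ * B / z ^ 2) := by
  have hn' : (0 : ℝ) < n := Nat.cast_pos.2 hn
  have hk0 : 0 ≤ (D.s : ℝ) + D.m := by positivity
  rcases hk0.eq_or_lt with hk | hk
  · simp [← hk, nrm_eq_zero_of_card hk.symm]
  have hL : ∀ i, MemLp (D.resid b y i) 2 P ∧ ∫ ω, D.resid b y i ω ^ 2 ∂P ≤ v₀ := fun i =>
    memLp_two_of_expMoment (hy.measurable_resid i) hK (hmom i).1 (hmom i).2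
  have hj : ∀ j, Integrable (fun ω => D.score b (y ω) j ^ 2) P ∧
      ∫ ω, D.score b (y ω) j ^ 2 ∂P ≤ v₀ * B / n := fun j => by
    have h1 := integral_sq_weighted_sum_le hy.iIndepFun_resid (fun i => (hL i).1)
      (hy.integral_resid h) (fun i => (hL i).2) fun i => D.X i j
    simp only [score_eq, mul_pow]
    refine ⟨h1.1.const_mul _, ?_⟩
    rw [integral_const_mul]
    calc (1 / (n : ℝ)) ^ 2 * ∫ ω, (∑ i, D.X i j * D.resid b y i ω) ^ 2 ∂P
        ≤ (1 / (n : ℝ)) ^ 2 * (v₀ * (B * n)) := by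
          gcongr
          exact h1.2.trans (mul_le_mul_of_nonneg_left (hB j) hv₀)
      _ = v₀ * B / n := by field_simp
  have hint : Integrable (fun ω => D.nrm (D.score b (y ω)) ^ 2) P := by
    simp only [nrm_sq]
    exact integrable_finsetSum _ fun j _ => (hj j).1
  have hle : ∫ ω, D.nrm (D.score b (y ω)) ^ 2 ∂P ≤ ((D.s : ℝ) + D.m) * (v₀ * B / n) := by
    simp only [nrm_sq]
    rw [integral_finsetSum _ fun j _ => (hj j).1, ← D.card_MS, ← nsmul_eq_mul]
    exact Finset.sum_le_card_nsmul _ _ _ fun j _ => (hj j).2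
  set q := Real.sqrt (((D.s : ℝ) + D.m) / n) with hq
  have hqpos : 0 < q := Real.sqrt_pos.2 (by positivity)
  have hmarkov := mul_meas_ge_le_integral_of_nonneg (μ := P)
    (f := fun ω => D.nrm (D.score b (y ω)) ^ 2) (ae_of_all _ fun ω => sq_nonneg _) hint
    ((z * q) ^ 2)
  have hsub : {ω | z * q < D.nrm (D.score b (y ω))} ⊆
      {ω | (z * q) ^ 2 ≤ D.nrm (D.score b (y ω)) ^ 2} := fun ω hω => by
    have h1 : z * q < D.nrm (D.score b (y ω)) := hω
    exact pow_le_pow_left₀ (mul_nonneg hz.le hqpos.le) h1.le 2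
  refine (measure_mono hsub).trans ?_
  rw [← ofReal_measureReal]
  refine ENNReal.ofReal_le_ofReal ?_
  rw [le_div_iff₀ (by positivity)]
  have hq2 : q ^ 2 = ((D.s : ℝ) + D.m) / n := Real.sq_sqrt (by positivity)
  have h1 := hmarkov.trans hle
  have h2 : ((D.s : ℝ) + D.m) * (v₀ * B / n) = v₀ * B * q ^ 2 := by rw [hq2]; ring
  rw [h2, mul_pow] at h1
  refine le_of_mul_le_mul_right ?_ (by positivity : 0 < q ^ 2)
  linarith

theorem IsSample.measure_score_ge_le [IsProbabilityMeasure P] (hy : D.IsSample ν b c φ P y)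
    (h : IsExponentialFamily ν b c φ) (hn : 0 < n) (hp : 2 ≤ D.p) {K v₀ B₁ B₂ : ℝ} (hK : 0 < K)
    (hv₀ : 0 ≤ v₀)
    (hmom : ∀ i, Integrable
        (fun ω => Real.exp (|D.resid b y i ω| / K) - 1 - |D.resid b y i ω| / K) P ∧
      (∫ ω, (Real.exp (|D.resid b y i ω| / K) - 1 - |D.resid b y i ω| / K) ∂P) * K ^ 2 ≤ v₀ / 2)
    (hB₁ : ∀ j, ∑ i, D.X i j ^ 2 ≤ B₁ * n)
    (hB₂ : ∀ j i, |D.X i j| ≤ B₂ * Real.sqrt (n / Real.log D.p))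
    {δ L T : ℝ} (hδ : 0 ≤ δ) (hδK : δ * B₂ * K ≤ 1) (hT : 0 ≤ T)
    (hL : 1 + δ ^ 2 * (v₀ / 2) * B₁ + T ≤ δ * L) :
    P {ω | ∃ j, L * Real.sqrt (Real.log D.p / n) ≤ |D.score b (y ω) j|} ≤
      ENNReal.ofReal (2 * Real.exp (-T * Real.log 2)) := by
  have hn' : (0 : ℝ) < n := Nat.cast_pos.2 hn
  have hp' : (2 : ℝ) ≤ D.p := by exact_mod_cast hp
  have hlog2 : 0 < Real.log 2 := Real.log_pos (by norm_num)
  have hlogp : Real.log 2 ≤ Real.log D.p := Real.log_le_log (by norm_num) hp'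
  have hlogp0 : 0 < Real.log D.p := hlog2.trans_le hlogp
  set ρ := Real.sqrt (Real.log D.p / n) with hρ
  have hρ2 : ρ ^ 2 * n = Real.log D.p := by
    rw [hρ, Real.sq_sqrt (by positivity), div_mul_cancel₀ _ hn'.ne']
  have hρ1 : ρ * Real.sqrt (n / Real.log D.p) = 1 := by
    rw [hρ, ← Real.sqrt_mul (by positivity), div_mul_div_cancel₀ hn'.ne', div_self hlogp0.ne',
      Real.sqrt_one]
  have hmgf : ∀ i, ∀ t : ℝ, |t| * K ≤ 1 → Integrable (fun ω => Real.exp (t * D.resid b y i ω)) P ∧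
      mgf (D.resid b y i) P t ≤ Real.exp (t ^ 2 * (v₀ / 2)) := fun i t ht =>
    mgf_le_of_expMoment (hy.measurable_resid i) (hy.integrable_resid h i) (hy.integral_resid h i)
      hK (hmom i).1 (hmom i).2 ht
  have hone : ∀ j, ∀ σ : ℝ, |σ| = 1 →
      P.real {ω | L * ρ * n ≤ ∑ i, σ * D.X i j * D.resid b y i ω} ≤
        Real.exp (-(1 + T) * Real.log D.p) := fun j σ hσ => by
    -- With `t = δρ`, the entry bound `B₂√(n/log p)` cancels against `ρ` to give `t|x_ij|K ≤ δB₂K ≤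
    -- 1`, and every term of the exponent is a multiple of `log p`.
    have h1 := measure_weighted_sum_ge_le hy.iIndepFun_resid hy.measurable_resid hmgf
      (fun i => σ * D.X i j) (t := δ * ρ) (by positivity) (fun i => by
        rw [abs_mul, hσ, one_mul]
        calc δ * ρ * |D.X i j| * K
            ≤ δ * ρ * (B₂ * Real.sqrt (n / Real.log D.p)) * K := by
              gcongr
              exact hB₂ j i
          _ = δ * B₂ * K * (ρ * Real.sqrt (n / Real.log D.p)) := by ring
          _ ≤ 1 := by rw [hρ1, mul_one]; exact hδK) (L * ρ * n)
    refine h1.trans (Real.exp_le_exp.2 ?_)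
    have h2 : ∑ i, (σ * D.X i j) ^ 2 ≤ B₁ * n := by
      refine (le_of_eq ?_).trans (hB₁ j)
      exact Finset.sum_congr rfl fun i _ => by rw [mul_pow, ← sq_abs σ, hσ]; ring
    have h3 := mul_le_mul_of_nonneg_left h2 (by positivity : 0 ≤ (δ * ρ) ^ 2 * (v₀ / 2))
    have h4 := mul_le_mul_of_nonneg_right hL hlogp0.le
    have h5 : (δ * ρ) ^ 2 * (v₀ / 2) * (B₁ * n) = δ ^ 2 * (v₀ / 2) * B₁ * Real.log D.p := by
      rw [← hρ2]; ring
    have h6 : -(δ * ρ) * (L * ρ * n) = -(δ * L * Real.log D.p) := by rw [← hρ2]; ring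
    rw [h6]
    linarith
  have hsub : {ω | ∃ j, L * ρ ≤ |D.score b (y ω) j|} ⊆
      ⋃ j, ({ω | L * ρ * n ≤ ∑ i, 1 * D.X i j * D.resid b y i ω} ∪
        {ω | L * ρ * n ≤ ∑ i, -1 * D.X i j * D.resid b y i ω}) := by
    rintro ω ⟨j, hj⟩
    refine Set.mem_iUnion.2 ⟨j, ?_⟩
    rw [score_eq, abs_mul, abs_of_pos (by positivity : 0 < 1 / (n : ℝ)), one_div, inv_mul_eq_div,
      le_div_iff₀ hn'] at hj
    rcases le_abs.1 hj with h1 | h1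
    · left
      simpa using h1
    · right
      simpa using h1
  rw [← ofReal_measureReal]
  refine ENNReal.ofReal_le_ofReal ?_
  calc P.real {ω | ∃ j, L * ρ ≤ |D.score b (y ω) j|}
      ≤ ∑ j : Fin D.p, P.real ({ω | L * ρ * n ≤ ∑ i, 1 * D.X i j * D.resid b y i ω} ∪
        {ω | L * ρ * n ≤ ∑ i, -1 * D.X i j * D.resid b y i ω}) :=
        (measureReal_mono hsub).trans (measureReal_iUnion_fintype_le _)
    _ ≤ ∑ _j : Fin D.p, 2 * Real.exp (-(1 + T) * Real.log D.p) := by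
        refine Finset.sum_le_sum fun j _ => (measureReal_union_le _ _).trans ?_
        have h1 := hone j 1 (by simp)
        have h2 := hone j (-1) (by simp)
        linarith
    -- The `1` in `1 + T` pays for the union over `p` columns. As `p` need not grow, `p⁻ᵀ` is then
    -- bounded only by `2⁻ᵀ`.
    _ = 2 * Real.exp (-T * Real.log D.p) := by
        rw [Finset.sum_const, Finset.card_univ, Fintype.card_fin, nsmul_eq_mul]
        nth_rw 1 [← Real.exp_log (by linarith : (0 : ℝ) < D.p)]
        rw [mul_left_comm, ← Real.exp_add]
        ring_nf
    _ ≤ 2 * Real.exp (-T * Real.log 2) := by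
        have := mul_le_mul_of_nonneg_left hlogp hT
        have := Real.exp_le_exp.2 (by linarith : -T * Real.log D.p ≤ -T * Real.log 2)
        linarith

end Design

/-! ### Asymptotics. -/

theorem eventually_mul_size_le {D : (n : ℕ) → Design n}
    (hsm : (fun n => ((D n).s : ℝ) + (D n).m) =o[atTop] fun n : ℕ => (n : ℝ) ^ (1 / 2 : ℝ))
    {c : ℝ} (hc : 0 ≤ c) : ∀ᶠ n in atTop, c * (((D n).s : ℝ) + (D n).m) ≤ Real.sqrt n := by
  filter_upwards [hsm.bound (by positivity : (0 : ℝ) < 1 / (c + 1))] with n hn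
  rw [← Real.sqrt_eq_rpow, Real.norm_of_nonneg (by positivity),
    Real.norm_of_nonneg (Real.sqrt_nonneg _), one_div, inv_mul_eq_div,
    le_div_iff₀ (by positivity)] at hn
  have : 0 ≤ ((D n).s : ℝ) + (D n).m := by positivity
  linarith

theorem eventually_rate_le {D : (n : ℕ) → Design n} (hrate : LambdaRate D)
    (hlam : ∀ n, 0 < (D n).lam) {A η : ℝ} (hA : 0 ≤ A) (hη : 0 < η) :
    ∀ᶠ n in atTop, A * Real.sqrt ((((D n).s : ℝ) + (D n).m) / n) ≤ η * (D n).lam ∧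
      A * Real.sqrt (Real.log (D n).p / n) ≤ η * (D n).lam := by
  filter_upwards [hrate.bound (by positivity : (0 : ℝ) < η / (A + 1))] with n hn
  rw [Real.norm_of_nonneg (by positivity), Real.norm_of_nonneg (hlam n).le] at hn
  have key : ∀ x : ℝ, 0 ≤ x → Real.sqrt x ≤ max (Real.sqrt (((D n).s : ℝ) + (D n).m))
      (Real.sqrt (Real.log (D n).p)) → A * Real.sqrt (x / n) ≤ η * (D n).lam := fun x hx hle => by
    have h1 : Real.sqrt (x / n) ≤ η / (A + 1) * (D n).lam := by
      rw [Real.sqrt_div hx]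
      exact (div_le_div_of_nonneg_right hle (Real.sqrt_nonneg _)).trans hn
    calc A * Real.sqrt (x / n) ≤ (A + 1) * (η / (A + 1) * (D n).lam) := by
          gcongr
          linarith
      _ = η * (D n).lam := by field_simp
  exact ⟨key _ (by positivity) (le_max_left _ _),
    key _ (Real.log_natCast_nonneg _) (le_max_right _ _)⟩

/-- If feasible sets come close to the true coefficient vector, then a minimizer of the loss over
them has, with probability tending to one, small gradient outside `M ∪ S` and large coefficients
in `S`. -/
theorem tendsto_measure_events (ν : Measure ℝ) (b c : ℝ → ℝ) (φ : ℝ)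
    (hfam : IsExponentialFamily ν b c φ) (D : (n : ℕ) → Design n) (hp : ∀ n, 2 ≤ (D n).p)
    (hlam : ∀ n, 0 < (D n).lam) (a a₁ : ℝ) (ha₁ : 0 < a₁)
    {Ω : ℕ → Type*} [∀ n, MeasurableSpace (Ω n)]
    (P : ∀ n, Measure (Ω n)) [∀ n, IsProbabilityMeasure (P n)] (y : ∀ n, Ω n → Fin n → ℝ)
    (hy : ∀ n, (D n).IsSample ν b c φ (P n) (y n))
    (F : ∀ n, Set (Fin (D n).p → ℝ)) (hF : ∀ n, F n ⊆ (D n).fullFeasible)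
    (C : ℝ) (hC : 0 ≤ C)
    (hnear : ∀ᶠ n in atTop, ∃ β ∈ F n,
      (D n).nrm (β - (D n).βs) ≤ C * Real.sqrt ((((D n).s : ℝ) + (D n).m) / n))
    (βhat : ∀ n, Ω n → Fin (D n).p → ℝ)
    (hhat : Tendsto (fun n => P n {ω | ¬ (βhat n ω ∈ F n ∧
      IsMinOn ((D n).loss b (y n ω)) (F n) (βhat n ω))}) atTop (𝓝 0))
    (hsignal : MinSignal D a) (hrate : LambdaRate D) (hhess : HessianConditions D b)
    (hcol : ColumnBounds D) (hmom : MomentBound P D b y)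
    (hsm : (fun n => ((D n).s : ℝ) + (D n).m) =o[atTop] fun n : ℕ => (n : ℝ) ^ (1 / 2 : ℝ)) :
    Tendsto (fun n => P n (gradEvent (D n) b a₁ (y n) (βhat n) ∪
      smallEvent (D n) a (βhat n))) atTop (𝓝 0) := by
  obtain ⟨κ, hκ, hmin⟩ := hhess.min_hessian
  obtain ⟨K₃', hthird'⟩ := hhess.third_derivative
  obtain ⟨K₂', hmax'⟩ := hhess.max_hessian
  obtain ⟨K₄', hcross'⟩ := hhess.cross_hessian
  obtain ⟨B₁, B₂, hB⟩ := hcol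
  obtain ⟨K, v₀, hK, hv₀, hmom⟩ := hmom
  have hb := contDiff_cumulant hfam
  have hconv := convexOn_of_iteratedDeriv_two hb (iteratedDeriv_two_cumulant_nonneg hfam)
  -- The constants supplied by the assumptions may be negative; truncation at zero makes the later
  -- estimates monotone.
  set K₂ := max K₂' 0 with hK₂def
  set K₃ := max K₃' 0 with hK₃def
  set K₄ := max K₄' 0 with hK₄def
  have hK₂ : 0 ≤ K₂ := le_max_right _ _
  have hK₃ : 0 ≤ K₃ := le_max_right _ _
  have hK₄ : 0 ≤ K₄ := le_max_right _ _
  set δ := 1 / ((|B₂| + 1) * K) with hδdef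
  have hδ : 0 < δ := by positivity
  have hδK : δ * B₂ * K ≤ 1 := by
    have h1 : δ * B₂ * K = B₂ / (|B₂| + 1) := by rw [hδdef]; field_simp
    rw [h1, div_le_one (by positivity)]
    linarith [le_abs_self B₂]
  set η := min 1 (a₁ / (2 * (K₄ + K₃ / 2 + 1))) with hηdef
  have hη : 0 < η := lt_min one_pos (by positivity)
  have hηK : (K₄ + K₃ / 2) * η ≤ a₁ / 2 := by
    have h1 : η ≤ a₁ / (2 * (K₄ + K₃ / 2 + 1)) := min_le_right _ _
    rw [le_div_iff₀ (by positivity)] at h1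
    linarith
  have main : ∀ A : ℝ, 0 < A → C ≤ A → (K₂ / 2 + K₃ / 6) * C ^ 2 < κ * A ^ 2 / 4 →
      ∀ᶠ n in atTop, P n (gradEvent (D n) b a₁ (y n) (βhat n) ∪ smallEvent (D n) a (βhat n)) ≤
        P n {ω | ¬ (βhat n ω ∈ F n ∧ IsMinOn ((D n).loss b (y n ω)) (F n) (βhat n ω))} +
        ENNReal.ofReal (v₀ * B₁ / (κ * A / 8) ^ 2) +
        ENNReal.ofReal (2 * Real.exp (-A * Real.log 2)) := by
    intro A hA hCA hAκ
    set L := (1 + δ ^ 2 * (v₀ / 2) * |B₁| + A) / δ with hLdef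
    have hL0 : 0 ≤ L := by positivity
    have hL : 1 + δ ^ 2 * (v₀ / 2) * B₁ + A ≤ δ * L := by
      rw [hLdef, mul_div_cancel₀ _ hδ.ne']
      have := mul_le_mul_of_nonneg_left (le_abs_self B₁) (by positivity : 0 ≤ δ ^ 2 * (v₀ / 2))
      linarith
    have hlog : ∀ᶠ n : ℕ in atTop, A ^ 2 ≤ Real.log n :=
      (Real.tendsto_log_atTop.comp tendsto_natCast_atTop_atTop).eventually_ge_atTop _
    filter_upwards [eventually_gt_atTop 0, hlog, eventually_mul_size_le hsm hC,
      eventually_mul_size_le hsm (sq_nonneg A), eventually_rate_le hrate hlam hA.le hη,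
      eventually_rate_le hrate hlam hL0 (by positivity : 0 < a₁ / 2), hnear, hmin, hthird',
      hmax', hcross', hsignal] with n hn hlog hCsm hAsm hR hLp hnear hmin hthird' hmax' hcross'
      hsignal
    have hn' : (1 : ℝ) ≤ n := by exact_mod_cast hn
    have hn0 : (0 : ℝ) < n := by linarith
    have hthird : ∀ β ∈ (D n).N0, ∀ j,
        LamMaxLE ((D n).XMSᵀ * (D n).thirdDiag b β j * (D n).XMS) (K₃ * n) := fun β hβ j =>
      (hthird' β hβ j).mono (mul_le_mul_of_nonneg_right (le_max_left _ _) hn0.le)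
    have hmax : LamMaxLE ((D n).XMSᵀ * (D n).Sig b (D n).βs * (D n).XMS) (K₂ * n) :=
      hmax'.mono (mul_le_mul_of_nonneg_right (le_max_left _ _) hn0.le)
    have hcross : ∀ j, ∑ k, |((D n).XMScᵀ * (D n).Sig b (D n).βs * (D n).XMS) j k| ≤ K₄ * n :=
      fun j => (hcross' j).trans (mul_le_mul_of_nonneg_right (le_max_left _ _) hn0.le)
    obtain ⟨β', hβ'F, hβ'⟩ := hnear
    set q := Real.sqrt ((((D n).s : ℝ) + (D n).m) / n) with hq
    have hrad : A * q ≤ Real.sqrt ((((D n).s : ℝ) + (D n).m) * Real.log n / n) := by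
      refine Real.le_sqrt_of_sq_le ?_
      rw [mul_pow, hq, Real.sq_sqrt (by positivity), mul_div_assoc', mul_comm (A ^ 2)]
      gcongr
    -- Allows the quadratic remainder in the gradient to be bounded linearly, `r² ≤ r`.
    have hAq1 : A * q ≤ 1 := by
      refine (sq_le_one_iff₀ (by positivity)).1 ?_
      rw [mul_pow, hq, Real.sq_sqrt (by positivity), mul_div_assoc', div_le_one hn0]
      exact hAsm.trans (Real.sqrt_le_self_iff.2 (Or.inr hn'))
    have htail₁ := (hy n).measure_nrm_score_le hfam hn hK hv₀.le (hmom n)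
      (fun j => (hB n j).1) (by positivity : 0 < κ * A / 8)
    have htail₂ := (hy n).measure_score_ge_le hfam hn (hp n) hK hv₀.le (hmom n)
      (fun j => (hB n j).1) (fun j => (hB n j).2) hδ.le hδK hA.le hL
    refine le_trans (measure_mono ?_) ((measure_union_le _ _).trans
      (add_le_add ((measure_union_le _ _).trans (add_le_add le_rfl htail₁)) htail₂))
    intro ω hω
    -- Outside the three exceptional events (not a minimizer, large score norm, large score
    -- coordinate) neither bad conclusion can occur.
    by_contra hnot
    simp only [Set.mem_union, Set.mem_ofPred_eq, not_or, not_not, not_lt, not_exists, not_le]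
      at hnot
    obtain ⟨⟨⟨hfeas, hmino⟩, hsc⟩, hsj⟩ := hnot
    have hclose : (D n).nrm (βhat n ω - (D n).βs) ≤ A * q :=
      Design.nrm_sub_le_of_score_le hb hconv hn hK₂ hK₃ hC hCA hAκ hmin hmax hthird hlog hCsm
        (y n ω) (hF n hfeas) (hF n hβ'F) hβ' (hmino hβ'F) hsc
    set r := (D n).nrm (βhat n ω - (D n).βs) with hr
    have hr0 : 0 ≤ r := (D n).nrm_nonneg _
    have hrη : r ≤ η * (D n).lam := hclose.trans hR.1
    rcases hω with ⟨j, hj, hge⟩ | ⟨j, hj, hle⟩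
    · have h1 := Design.abs_grad_le hb hn hthird hcross (y n ω) (hF n hfeas)
        (hclose.trans hrad) hj
      rw [← hr] at h1
      have h2 := hsj j
      have h3 : r ^ 2 ≤ r := by nlinarith
      have h4 : K₃ * r ^ 2 ≤ K₃ * r := mul_le_mul_of_nonneg_left h3 hK₃
      have h5 : (K₄ + K₃ / 2) * r ≤ (K₄ + K₃ / 2) * (η * (D n).lam) := by gcongr
      have h6 := mul_le_mul_of_nonneg_right hηK (hlam n).le
      have h7 := hLp.2
      linarith
    · have h1 := hsignal j hj
      have h2 : |(βhat n ω - (D n).βs) j| ≤ r :=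
        (D n).abs_le_nrm _ (Finset.mem_union_right _ hj)
      have h3 : |(D n).βs j| ≤ |βhat n ω j| + |(βhat n ω - (D n).βs) j| := by
        have := abs_sub (βhat n ω j) ((βhat n ω - (D n).βs) j)
        rwa [Pi.sub_apply, sub_sub_cancel] at this
      have h4 : η * (D n).lam ≤ 1 * (D n).lam :=
        mul_le_mul_of_nonneg_right (min_le_left _ _) (hlam n).le
      linarith
  rw [ENNReal.tendsto_nhds_zero] at hhat ⊢
  intro ε hε
  have hε3 : 0 < ε / 3 := ENNReal.div_pos hε.ne' (by norm_num)
  have hlim₁ : Tendsto (fun A : ℝ => ENNReal.ofReal (v₀ * B₁ / (κ * A / 8) ^ 2)) atTop (𝓝 0) := by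
    have h1 : Tendsto (fun A : ℝ => (κ * A / 8) ^ 2) atTop atTop :=
      (tendsto_pow_atTop (by norm_num)).comp
        ((tendsto_id.const_mul_atTop hκ).atTop_div_const (by norm_num))
    simpa using ENNReal.tendsto_ofReal (h1.const_div_atTop (v₀ * B₁))
  have hlim₂ : Tendsto (fun A : ℝ => ENNReal.ofReal (2 * Real.exp (-A * Real.log 2))) atTop
      (𝓝 0) := by
    have h1 : Tendsto (fun A : ℝ => -A * Real.log 2) atTop atBot :=
      tendsto_neg_atTop_atBot.atBot_mul_const (Real.log_pos (by norm_num))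
    simpa using ENNReal.tendsto_ofReal ((Real.tendsto_exp_atBot.comp h1).const_mul 2)
  have hlim₃ : Tendsto (fun A : ℝ => κ * A ^ 2 / 4) atTop atTop :=
    ((tendsto_pow_atTop (by norm_num)).const_mul_atTop hκ).atTop_div_const (by norm_num)
  -- Now `A` is chosen large enough that each score tail is at most `ε/3`; only afterwards does `n`
  -- grow.
  obtain ⟨A, hA, hCA, hAκ, h₁, h₂⟩ := ((eventually_gt_atTop (0 : ℝ)).and
    ((eventually_ge_atTop C).and ((hlim₃.eventually_gt_atTop ((K₂ / 2 + K₃ / 6) * C ^ 2)).and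
      ((ENNReal.tendsto_nhds_zero.1 hlim₁ _ hε3).and
        (ENNReal.tendsto_nhds_zero.1 hlim₂ _ hε3))))).exists
  filter_upwards [main A hA hCA hAκ, hhat _ hε3] with n h3 h4
  calc _ ≤ _ := h3
    _ ≤ ε / 3 + ε / 3 + ε / 3 := by gcongr
    _ = ε := ENNReal.add_thirds ε

theorem eventually_exists_reducedFeasible_near {D : (n : ℕ) → Design n}
    (hrank : ∀ n, (D n).C.rank = (D n).r) (hlocal : LocalAlternatives D) :
    ∃ C : ℝ, 0 ≤ C ∧ ∀ᶠ n in atTop, ∃ β ∈ (D n).reducedFeasible,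
      (D n).nrm (β - (D n).βs) ≤ C * Real.sqrt ((((D n).s : ℝ) + (D n).m) / n) := by
  obtain ⟨K, hK⟩ := hlocal.eig_C
  obtain ⟨R, hR, hrate⟩ := hlocal.rate_h.exists_nonneg
  refine ⟨Real.sqrt (max K 0) * R, by positivity, ?_⟩
  filter_upwards [hK, hrate.bound] with n hKn hn
  obtain ⟨β, hβ, hle⟩ := Design.exists_reducedFeasible_near (hrank n) (le_max_right K 0)
    (hKn.mono (le_max_left K 0))
  refine ⟨β, hβ, hle.trans ?_⟩
  rw [mul_assoc]
  refine mul_le_mul_of_nonneg_left ?_ (Real.sqrt_nonneg _)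
  rw [Real.norm_of_nonneg (Real.sqrt_nonneg _)] at hn
  refine (le_abs_self _).trans (hn.trans (mul_le_mul_of_nonneg_left ?_ hR))
  -- The minimum in the rate of `h` is bounded crudely by `s + m`, the scale of the estimation
  -- error.
  refine Real.sqrt_le_sqrt (div_le_div_of_nonneg_right ((min_le_left _ _).trans ?_) n.cast_nonneg)
  exact sub_le_self _ (Nat.cast_nonneg _)

end PartialGLM

/-! ### The two oracle estimators. -/

theorem mainTheorem6
    -- the exponential family
    (ν : MeasureTheory.Measure ℝ) (b c : ℝ → ℝ) (φ : ℝ)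
    (hfam : PartialGLM.IsExponentialFamily ν b c φ)
    -- the deterministic data
    (D : (n : ℕ) → PartialGLM.Design n)
    (hp : ∀ n, 2 ≤ (D n).p)
    (hlogp : ∃ η : ℝ, 0 < η ∧ η < 1 ∧
      (fun n => Real.log (D n).p) =O[Filter.atTop] fun n : ℕ => (n : ℝ) ^ η)
    (hrank : ∀ n, (D n).C.rank = (D n).r)
    (hlam : ∀ n, 0 < (D n).lam)
    (a a₁ : ℝ) (ha : 0 < a) (ha₁ : 0 < a₁)
    -- the responses
    {Ω : ℕ → Type*} [∀ n, MeasurableSpace (Ω n)]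
    (P : ∀ n, MeasureTheory.Measure (Ω n)) [∀ n, MeasureTheory.IsProbabilityMeasure (P n)]
    (y : ∀ n, Ω n → Fin n → ℝ)
    (hy : ∀ n, (D n).IsSample ν b c φ (P n) (y n))
    -- the reduced and the full oracle estimators
    (β₀ βa : ∀ n, Ω n → Fin (D n).p → ℝ)
    (h₀ : Filter.Tendsto (fun n => P n {ω | ¬ ((D n).IsReducedOracle b (y n ω) (β₀ n ω) ∧
      (D n).ReducedStationary b (y n ω) (β₀ n ω))}) Filter.atTop (nhds 0))
    (ha₂ : Filter.Tendsto (fun n => P n {ω | ¬ ((D n).IsFullOracle b (y n ω) (βa n ω) ∧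
      (D n).FullStationary b (y n ω) (βa n ω))}) Filter.atTop (nhds 0))
    -- the remaining assumptions
    (hsignal : PartialGLM.MinSignal D a)
    (hlocal : PartialGLM.LocalAlternatives D)
    (hrate : PartialGLM.LambdaRate D)
    (hhess : PartialGLM.HessianConditions D b)
    (hcol : PartialGLM.ColumnBounds D)
    (hmom : PartialGLM.MomentBound P D b y)
    (hsm : (fun n => ((D n).s : ℝ) + (D n).m) =o[Filter.atTop]
      fun n : ℕ => (n : ℝ) ^ (1 / 2 : ℝ)) :
    Filter.Tendsto (fun n => P n (PartialGLM.gradEvent (D n) b a₁ (y n) (β₀ n)))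
        Filter.atTop (nhds 0) ∧
    Filter.Tendsto (fun n => P n (PartialGLM.smallEvent (D n) a (β₀ n)))
        Filter.atTop (nhds 0) ∧
    Filter.Tendsto (fun n => P n (PartialGLM.gradEvent (D n) b a₁ (y n) (βa n)))
        Filter.atTop (nhds 0) ∧
    Filter.Tendsto (fun n => P n (PartialGLM.smallEvent (D n) a (βa n)))
        Filter.atTop (nhds 0) := by
  have hle : ∀ {A B : ∀ n, Set (Ω n)},
      Filter.Tendsto (fun n => P n (B n)) Filter.atTop (nhds 0) → (∀ n, A n ⊆ B n) →
      Filter.Tendsto (fun n => P n (A n)) Filter.atTop (nhds 0) := fun hB hAB =>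
    tendsto_of_tendsto_of_tendsto_of_le_of_le tendsto_const_nhds hB (fun _ => zero_le)
      fun n => measure_mono (hAB n)
  obtain ⟨C, hC, hnear⟩ := PartialGLM.eventually_exists_reducedFeasible_near hrank hlocal
  have hreduced := PartialGLM.tendsto_measure_events ν b c φ hfam D hp hlam a a₁ ha₁ P y hy
    (fun n => (D n).reducedFeasible) (fun n β hβ => hβ.1) C hC hnear β₀
    (hle h₀ fun n ω hω h => hω h.1) hsignal hrate hhess hcol hmom hsm
  -- Here `β*` is itself feasible, so the nearby point is at distance `0` and the constant is `0`.
  have hfull := PartialGLM.tendsto_measure_events ν b c φ hfam D hp hlam a a₁ ha₁ P y hy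
    (fun n => (D n).fullFeasible) (fun n β hβ => hβ) 0 le_rfl
    (Filter.Eventually.of_forall fun n => ⟨(D n).βs, (D n).βs_mem_fullFeasible, by
      simp [PartialGLM.Design.nrm]⟩) βa
    (hle ha₂ fun n ω hω h => hω h.1) hsignal hrate hhess hcol hmom hsm
  exact ⟨hle hreduced fun n => Set.subset_union_left,
    hle hreduced fun n => Set.subset_union_right,
    hle hfull fun n => Set.subset_union_left,
    hle hfull fun n => Set.subset_union_right⟩
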